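/- Let $M\subset\mathbb R^3$ be a compact, oriented, embedded $C^\infty$ surface with (possibly empty) boundary $\partial M$, with continuous unit normal field $\mathbf N$ and area element $dA$. Let $\partial M$ carry the induced orientation: its positively oriented unit tangent vector $\mathbf T$ is the one for which $\mathbf N\times\mathbf T$ points into $M$. Let $\mathbf P,\mathbf Q:M\to\mathbb R^3$ be arbitrary (not necessarily continuous, nor even measurable) vector fields on $M$ such that at every point of $M$ the vectors $\mathbf P,\mathbf Q$ are orthonormal and $\mathbf P\times\mathbf Q=\mathbf N$; in particular $\mathbf P,\mathbf Q$ are tangent to $M$. For a function $h$, real- or vector-valued, that is continuously differentiable on a neighbourhood of $M$, let $\nabla_{\mathbf P}h=h_p$ and $\nabla_{\mathbf Q}h=h_q$ denote its directional derivatives in the directions $\mathbf P$ and $\mathbf Q$, and along $\partial M$ let $dh=\nabla_{\mathbf T}h\,ds$, where $s$ is arc length. (1) If $f,g$ are continuously differentiable real-valued functions on an open neighbourhood of $M$ in $\mathbb R^3$, then both integrands below are integrable and $$\int_{\partial M} f\,dg=\int_M\left[(\nabla_{\mathbf P}f)(\nabla_{\mathbf Q}g)-(\nabla_{\mathbf Q}f)(\nabla_{\mathbf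 P}g)\right]dA .$$ (2) Consequently, if $\mathbf V,\mathbf W$ are continuously differentiable $\mathbb R^3$-valued vector fields on an open neighbourhood of $M$ in $\mathbb R^3$ (for instance on all of $\mathbb R^3$), not necessarily tangent to $M$, then both integrands below are integrable and $$\int_{\partial M}\mathbf V\cdot d\mathbf W=\int_M\left(\mathbf V_p\cdot\mathbf W_q-\mathbf V_q\cdot\mathbf W_p\right)dA .$$ -/

import Mathlib

open MeasureTheory Set Manifold
open scoped ContDiff

noncomputable section

namespace EmbeddedSurface

/-- The Euclidean plane, in which the charts of a surface take their values. -/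
abbrev E2 : Type := EuclideanSpace ℝ (Fin 2)

/-- Euclidean three-space. -/
abbrev E3 : Type := EuclideanSpace ℝ (Fin 3)

/-- The cross product `v × w` of two vectors of Euclidean three-space. -/
def cross (v w : E3) : E3 := WithLp.toLp 2 (crossProduct (WithLp.ofLp v) (WithLp.ofLp w))

section Geometry

variable {M : Type*} [TopologicalSpace M] [ChartedSpace (EuclideanHalfSpace 2) M]

/-- The local parametrization of the surface `X : M → ℝ³` given by the inverse of the preferred
chart at `c`. It is defined on the target of that chart, a relatively open subset of the half-plane
`{u | 0 ≤ u 0}`, and the boundary points of `M` correspond to the points with `u 0 = 0`. -/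
def localParam (X : M → E3) (c : M) : E2 → E3 :=
  fun u => X ((extChartAt (𝓡∂ 2) c).symm u)

/-- The partial derivative `∂φ/∂uᵢ` of the local parametrization `φ` at `c` (one-sided, that is,
within the half-plane, at boundary points). -/
def partialParam (X : M → E3) (c : M) (i : Fin 2) (u : E2) : E3 :=
  fderivWithin ℝ (localParam X c) (range (𝓡∂ 2)) u (EuclideanSpace.single i 1)

/-- `N` is a continuous field of unit normal vectors along the surface `X : M → ℝ³`, i.e. an
orientation of the surface. -/
structure IsUnitNormal (X N : M → E3) : Prop where
  continuous : Continuous N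
  norm_eq_one : ∀ p, ‖N p‖ = 1
  inner_eq_zero : ∀ (p : M) (v : TangentSpace (𝓡∂ 2) p),
    inner ℝ (N p) (mfderiv (𝓡∂ 2) 𝓘(ℝ, E3) X p v : E3) = 0

/-- `(P, Q)` is a field of orthonormal pairs with `P × Q = N`. No regularity is required. Since `N`
is normal to the surface, the identity `P × Q = N` forces `P` and `Q` to be tangent to it. -/
structure IsOrientedFrame (N P Q : M → E3) : Prop where
  norm_left : ∀ p, ‖P p‖ = 1
  norm_right : ∀ p, ‖Q p‖ = 1
  inner_eq_zero : ∀ p, inner ℝ (P p) (Q p) = 0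
  cross_eq : ∀ p, cross (P p) (Q p) = N p

/-- The positively oriented unit tangent vector `T` of `∂M` at a boundary point `p`: in the chart at
`p` the vector `∂φ/∂u₁` is tangent to `∂M` and `∂φ/∂u₀` points into `M`, and `T` is the multiple of
`∂φ/∂u₁` of length one such that `N × T` points into `M`, i.e. `N ⬝ (T × ∂φ/∂u₀) > 0`.
(At interior points of `M` the value is meaningless and is never used.) -/
def boundaryTangent (X N : M → E3) (p : M) : E3 :=
  let u : E2 := extChartAt (𝓡∂ 2) p p
  let τ : E3 := partialParam X p 1 u
  let d : E3 := partialParam X p 0 u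
  ((SignType.sign (inner ℝ (N p) (cross τ d)) : ℝ) * ‖τ‖⁻¹) • τ

variable [MeasurableSpace M]

/-- The area of the part of the surface in the domain of the chart at `c`: the measure
`|∂φ/∂u₀ × ∂φ/∂u₁| du₀ du₁`, carried over to `M`. -/
def chartArea (X : M → E3) (c : M) : Measure M :=
  Measure.map (extChartAt (𝓡∂ 2) c).symm
    (((volume : Measure E2).restrict (extChartAt (𝓡∂ 2) c).target).withDensity
      fun u => ENNReal.ofReal ‖cross (partialParam X c 0 u) (partialParam X c 1 u)‖)

/-- The area measure `dA` of the surface. The measures `chartArea X c` agree on the overlaps of the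
charts, and `dA`, their least upper bound, is the measure obtained by gluing them together. -/
def areaMeasure (X : M → E3) : Measure M := ⨆ c : M, chartArea X c

/-- The length of the part of the boundary in the domain of the chart at `c`: the measure
`|∂φ/∂u₁ (0, t)| dt`, carried over to `M` by `t ↦ φ (0, t)`. -/
def chartLength (X : M → E3) (c : M) : Measure M :=
  Measure.map (fun t : ℝ => (extChartAt (𝓡∂ 2) c).symm (!₂[0, t] : E2))
    (((volume : Measure ℝ).restrict
        {t : ℝ | (!₂[0, t] : E2) ∈ (extChartAt (𝓡∂ 2) c).target}).withDensity
      fun t => ENNReal.ofReal ‖partialParam X c 1 (!₂[0, t] : E2)‖)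

/-- The arc length measure `ds` of `∂M`, as a measure on `M` carried by `∂M`. It is obtained by
gluing together the measures `chartLength X c`, which agree on the overlaps of the charts. -/
def boundaryMeasure (X : M → E3) : Measure M := ⨆ c : M, chartLength X c

end Geometry

end EmbeddedSurface

end

namespace EmbeddedSurface

open Filter Topology

/-! This is Stokes' theorem for the 1-form `f dg`, with `d(f dg) = df ∧ dg`. The analytic difficulty
is that `g` is only `C¹`, so `dg` need not be differentiable and Green's formula does not apply
directly to `f dg`.

On the half-plane the missing second derivative is avoided by translating along the boundary. The
`x`-derivative of `F(x,t) G(x,t+h)` involves first derivatives only, so its integral is the boundary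
integral of `-F(0,t) G(0,t+h)` for every `h` (`integral_halfPlane_translate`). After a shift,
differentiation at `h = 0` falls on one factor at a time and gives `∫ (F₀G₁ - F₁G₀) = -∫ F G₁`
(`integral_halfPlane`, `green_halfPlane`).

The surface enters through three facts. The measures `dA` and `ds` coincide on a chart domain with
the measures of that chart (`restrict_areaMeasure`, `restrict_boundaryMeasure`). The value of `df ∧
dg` on any oriented orthonormal frame, times the area density, is up to the orientation sign its
value on the coordinate vectors (`norm_cross_mul_wedge`), so neither continuity nor measurability of
the frame matters. The formula for the boundary tangent is the same in all charts
(`boundaryTangent_eq`).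

These give the theorem when `f` and `g` are supported in one chart
(`stokesHolds_of_tsupport_subset_chart`). A partition of unity for `f` and cut-offs for `g` give the
general case (`stokesHolds`), and summing over coordinates gives the version for vector fields. -/

/-! ### Green's formula on the half-plane for `C¹` functions. -/

theorem hasDerivAt_integral_mul {α : Type*} [MeasurableSpace α] {μ : Measure α} {a : α → ℝ}
    {b b' : α → ℝ → ℝ} {C : ℝ} (ha : Integrable a μ)
    (hb : ∀ h, AEStronglyMeasurable (fun x => b x h) μ)
    (hb' : AEStronglyMeasurable (fun x => b' x 0) μ)
    (hab : Integrable (fun x => a x * b x 0) μ)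
    (hC : ∀ x h, |b' x h| ≤ C) (hd : ∀ x h, HasDerivAt (b x) (b' x h) h) :
    HasDerivAt (fun h => ∫ x, a x * b x h ∂μ) (∫ x, a x * b' x 0 ∂μ) 0 := by
  refine (hasDerivAt_integral_of_dominated_loc_of_deriv_le (s := univ)
    (bound := fun x => |a x| * C) (F' := fun h x => a x * b' x h) univ_mem
    (Eventually.of_forall fun h => ha.aestronglyMeasurable.mul (hb h)) hab
    (ha.aestronglyMeasurable.mul hb') ?_ (ha.abs.mul_const C) ?_).2
  · refine Eventually.of_forall fun x h _ => ?_
    rw [norm_mul, Real.norm_eq_abs, Real.norm_eq_abs]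
    exact mul_le_mul_of_nonneg_left (hC x h) (abs_nonneg _)
  · exact Eventually.of_forall fun x h _ => (hd x h).const_mul _

/-- The substitution `t ↦ t + h` in the second integral turns the sum into the integral of
`∂ₓ(F(x,t) G(x,t+h))`. Fubini and the fundamental theorem of calculus in `x` leave only the value at
`x = 0`. -/
theorem integral_halfPlane_translate {F F₀ G G₀ : ℝ × ℝ → ℝ}
    (hF : Continuous F) (hF₀ : Continuous F₀) (hG : Continuous G) (hG₀ : Continuous G₀)
    (sF : HasCompactSupport F) (sF₀ : HasCompactSupport F₀)
    (dF : ∀ x t, 0 < x → HasDerivAt (fun x => F (x, t)) (F₀ (x, t)) x)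
    (dG : ∀ x t, 0 < x → HasDerivAt (fun x => G (x, t)) (G₀ (x, t)) x) (h : ℝ) :
    (∫ z in Ioi (0 : ℝ) ×ˢ univ, F₀ z * G (z.1, z.2 + h))
      + ∫ z in Ioi (0 : ℝ) ×ˢ univ, G₀ z * F (z.1, z.2 - h)
      = -∫ t, F (0, t) * G (0, t + h) := by
  have c1 : Continuous fun z : ℝ × ℝ => F₀ z * G (z.1, z.2 + h) := by fun_prop
  have c2 : Continuous fun z : ℝ × ℝ => F z * G₀ (z.1, z.2 + h) := by fun_prop
  have i1 : Integrable (fun z : ℝ × ℝ => F₀ z * G (z.1, z.2 + h)) :=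
    c1.integrable_of_hasCompactSupport sF₀.mul_right
  have i2 : Integrable (fun z : ℝ × ℝ => F z * G₀ (z.1, z.2 + h)) :=
    c2.integrable_of_hasCompactSupport sF.mul_right
  have shift : (∫ z in Ioi (0 : ℝ) ×ˢ univ, G₀ z * F (z.1, z.2 - h))
      = ∫ z in Ioi (0 : ℝ) ×ˢ univ, F z * G₀ (z.1, z.2 + h) := by
    have mp : MeasurePreserving (fun z : ℝ × ℝ => (z.1, z.2 + h))
        (volume.restrict (Ioi (0 : ℝ) ×ˢ univ)) (volume.restrict (Ioi (0 : ℝ) ×ˢ univ)) := by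
      rw [Measure.volume_eq_prod, ← Measure.prod_restrict, Measure.restrict_univ]
      exact (MeasurePreserving.id _).prod (measurePreserving_add_right volume h)
    have me : MeasurableEmbedding (fun z : ℝ × ℝ => (z.1, z.2 + h)) :=
      ((Homeomorph.refl ℝ).prodCongr (Homeomorph.addRight h)).measurableEmbedding
    rw [← mp.integral_comp me]
    refine integral_congr_ae (Eventually.of_forall fun z => ?_)
    simp [mul_comm]
  rw [shift, ← integral_add i1.integrableOn i2.integrableOn, ← integral_neg]
  have hint : IntegrableOn (fun z : ℝ × ℝ => F₀ z * G (z.1, z.2 + h) + F z * G₀ (z.1, z.2 + h))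
      (Ioi (0 : ℝ) ×ˢ univ) (volume.prod volume) := (i1.add i2).integrableOn
  rw [IntegrableOn, ← Measure.prod_restrict, Measure.restrict_univ] at hint
  rw [Measure.volume_eq_prod, ← Measure.prod_restrict, Measure.restrict_univ,
    integral_prod_symm _ hint]
  refine integral_congr_ae (Eventually.of_forall fun t => ?_)
  obtain ⟨R, hR⟩ := sF.isCompact.isBounded.subset_closedBall (0 : ℝ × ℝ)
  have zeroF : ∀ x, R < x → F (x, t) = 0 := by
    intro x hx
    by_contra hne
    have h1 := hR (subset_tsupport F hne)
    rw [mem_closedBall_zero_iff, Prod.norm_def] at h1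
    have h2 : ‖x‖ ≤ R := (le_max_left _ _).trans h1
    exact absurd ((le_abs_self x).trans h2) (not_le.mpr hx)
  -- For `x ≤ 0` nothing ties `F₀` to `F`, so its support needs a radius of its own.
  obtain ⟨R', hR'⟩ := sF₀.isCompact.isBounded.subset_closedBall (0 : ℝ × ℝ)
  have cs : HasCompactSupport fun x => F₀ (x, t) * G (x, t + h) + F (x, t) * G₀ (x, t + h) := by
    refine HasCompactSupport.of_support_subset_isCompact
      (isCompact_closedBall (0 : ℝ) (max R R')) fun x hx => ?_
    rw [mem_closedBall_zero_iff]
    by_cases h0 : F (x, t) = 0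
    · have h1 : F₀ (x, t) ≠ 0 := fun h1 => hx (by simp [h0, h1])
      have h2 := hR' (subset_tsupport F₀ h1)
      rw [mem_closedBall_zero_iff, Prod.norm_def] at h2
      exact ((le_max_left _ _).trans h2).trans (le_max_right _ _)
    · have h2 := hR (subset_tsupport F h0)
      rw [mem_closedBall_zero_iff, Prod.norm_def] at h2
      exact ((le_max_left _ _).trans h2).trans (le_max_left _ _)
  have key := integral_Ioi_of_hasDerivAt_of_tendsto (a := (0 : ℝ)) (m := 0)
    (f := fun x => F (x, t) * G (x, t + h))
    (f' := fun x => F₀ (x, t) * G (x, t + h) + F (x, t) * G₀ (x, t + h))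
    (by apply Continuous.continuousWithinAt; fun_prop)
    (fun x hx => (dF x t hx).mul (dG x (t + h) hx))
    ((Continuous.integrable_of_hasCompactSupport (by fun_prop) cs).integrableOn)
    (tendsto_const_nhds.congr' (by
      filter_upwards [eventually_gt_atTop R] with x hx
      simp [zeroF x hx]))
  simpa using key

/-- This is the derivative at `h = 0` of the translated identity. Only `G(x,t+h)` and `F(x,t-h)`
depend on `h`, so no second derivative appears, and the minus sign in `t - h` produces the
antisymmetry. -/
theorem integral_halfPlane {F F₀ F₁ G G₀ G₁ : ℝ × ℝ → ℝ}
    (hF : Continuous F) (hF₀ : Continuous F₀) (hF₁ : Continuous F₁)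
    (hG : Continuous G) (hG₀ : Continuous G₀) (hG₁ : Continuous G₁)
    (sF : HasCompactSupport F) (sF₀ : HasCompactSupport F₀) (sF₁ : HasCompactSupport F₁)
    (sG₀ : HasCompactSupport G₀) (sG₁ : HasCompactSupport G₁)
    (dF : ∀ x t, 0 < x → HasDerivAt (fun x => F (x, t)) (F₀ (x, t)) x)
    (dF' : ∀ x t, HasDerivAt (fun t => F (x, t)) (F₁ (x, t)) t)
    (dG : ∀ x t, 0 < x → HasDerivAt (fun x => G (x, t)) (G₀ (x, t)) x)
    (dG' : ∀ x t, HasDerivAt (fun t => G (x, t)) (G₁ (x, t)) t) :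
    ∫ z in Ioi (0 : ℝ) ×ˢ univ, (F₀ z * G₁ z - F₁ z * G₀ z) = -∫ t, F (0, t) * G₁ (0, t) := by
  obtain ⟨CF, hCF⟩ := hF₁.bounded_above_of_compact_support sF₁
  obtain ⟨CG, hCG⟩ := hG₁.bounded_above_of_compact_support sG₁
  have i1 : Integrable F₀ := hF₀.integrable_of_hasCompactSupport sF₀
  have i2 : Integrable G₀ := hG₀.integrable_of_hasCompactSupport sG₀
  have sF' : HasCompactSupport fun t => F (0, t) := by
    refine sF.comp_isClosedEmbedding (g := fun t : ℝ => ((0 : ℝ), t)) ?_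
    exact Topology.IsClosedEmbedding.of_continuous_injective_isClosedMap (by fun_prop)
      (fun a b h => (Prod.ext_iff.mp h).2) (isClosedMap_prodMk_left 0)
  have i3 : Integrable fun t => F (0, t) :=
    Continuous.integrable_of_hasCompactSupport (by fun_prop) sF'
  have D1 := hasDerivAt_integral_mul (μ := volume.restrict (Ioi (0 : ℝ) ×ˢ univ))
    (a := F₀) (b := fun z h => G (z.1, z.2 + h)) (b' := fun z h => G₁ (z.1, z.2 + h)) (C := CG)
    i1.integrableOn
    (fun h => Continuous.aestronglyMeasurable (by fun_prop))
    (Continuous.aestronglyMeasurable (by fun_prop))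
    (Continuous.integrable_of_hasCompactSupport (by fun_prop) sF₀.mul_right).integrableOn
    (fun z h => hCG _) (fun z h => by simpa using (dG' z.1 (z.2 + h)).comp_const_add z.2 h)
  have D2 := hasDerivAt_integral_mul (μ := volume.restrict (Ioi (0 : ℝ) ×ˢ univ))
    (a := G₀) (b := fun z h => F (z.1, z.2 - h)) (b' := fun z h => -F₁ (z.1, z.2 - h)) (C := CF)
    i2.integrableOn
    (fun h => Continuous.aestronglyMeasurable (by fun_prop))
    (Continuous.aestronglyMeasurable (by fun_prop))
    (Continuous.integrable_of_hasCompactSupport (by fun_prop) sG₀.mul_right).integrableOn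
    (fun z h => by rw [abs_neg]; exact hCF _)
    (fun z h => by simpa using (dF' z.1 (z.2 - h)).comp_const_sub z.2 h)
  have D3 := hasDerivAt_integral_mul (μ := (volume : Measure ℝ))
    (a := fun t => F (0, t)) (b := fun t h => G (0, t + h)) (b' := fun t h => G₁ (0, t + h))
    (C := CG) i3
    (fun h => Continuous.aestronglyMeasurable (by fun_prop))
    (Continuous.aestronglyMeasurable (by fun_prop))
    (Continuous.integrable_of_hasCompactSupport (by fun_prop) sF'.mul_right)
    (fun z h => hCG _) (fun t h => by simpa using (dG' 0 (t + h)).comp_const_add t h)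
  -- Both sides of the translated identity agree for all `h`, hence so do their derivatives at `0`.
  have E := (D1.add D2).unique (D3.neg.congr_of_eventuallyEq (Eventually.of_forall fun h =>
    integral_halfPlane_translate hF hF₀ hG hG₀ sF sF₀ dF dG h))
  simp only [add_zero, sub_zero] at E
  rw [← E, ← integral_add]
  · refine integral_congr_ae (Eventually.of_forall fun z => ?_)
    simp only [Prod.mk.eta]
    ring
  · exact (Continuous.integrable_of_hasCompactSupport (by fun_prop) sF₀.mul_right).integrableOn
  · exact (Continuous.integrable_of_hasCompactSupport (by fun_prop) sG₀.mul_right).integrableOn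

/-- The point `(|x|, t)` of the half-plane. -/
def foldPoint (z : ℝ × ℝ) : E2 := !₂[|z.1|, z.2]

theorem mem_range_halfPlane {u : E2} : u ∈ range (𝓡∂ 2) ↔ 0 ≤ u 0 := by
  rw [range_modelWithCornersEuclideanHalfSpace]; rfl

theorem continuous_foldPoint : Continuous foldPoint := by
  refine (PiLp.continuous_toLp 2 _).comp (continuous_pi fun i => ?_)
  fin_cases i
  · exact continuous_fst.abs
  · exact continuous_snd

theorem foldPoint_mem (z : ℝ × ℝ) : foldPoint z ∈ range (𝓡∂ 2) :=
  mem_range_halfPlane.mpr (abs_nonneg z.1)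

/-- Composition with `foldPoint` extends a function evenly across the boundary line; its support
lies in `K` together with the mirror image of `K`. The extension is continuous on the whole plane,
while differentiability in `x` is only needed for `x > 0`. -/
theorem hasCompactSupport_comp_foldPoint {f : E2 → ℝ} {K : Set E2} (hK : IsCompact K)
    (hf : ∀ u ∈ range (𝓡∂ 2), u ∉ K → f u = 0) : HasCompactSupport (f ∘ foldPoint) := by
  have hc : Continuous fun u : E2 => (u 0, u 1) := by fun_prop
  have hc' : Continuous fun u : E2 => (-u 0, u 1) := by fun_prop
  refine HasCompactSupport.of_support_subset_isCompact ((hK.image hc).union (hK.image hc'))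
    fun z hz => ?_
  have hzK : foldPoint z ∈ K := by
    by_contra h
    exact hz (hf _ (foldPoint_mem z) h)
  rcases le_total 0 z.1 with h | h
  · exact Or.inl ⟨_, hzK, by simp [foldPoint, abs_of_nonneg h]⟩
  · exact Or.inr ⟨_, hzK, by simp [foldPoint, abs_of_nonpos h]⟩

theorem hasDerivAt_foldPoint_fst {f : E2 → ℝ} (hf : DifferentiableOn ℝ f (range (𝓡∂ 2)))
    {x t : ℝ} (hx : 0 < x) :
    HasDerivAt (fun x => (f ∘ foldPoint) (x, t))
      (fderivWithin ℝ f (range (𝓡∂ 2)) (foldPoint (x, t)) (EuclideanSpace.single 0 1)) x := by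
  have hd : HasDerivAt (fun x : ℝ => (foldPoint (0, t) + x • EuclideanSpace.single 0 1 : E2))
      (EuclideanSpace.single 0 1) x := by
    simpa using ((hasDerivAt_id x).smul_const (EuclideanSpace.single (0 : Fin 2) (1 : ℝ))).const_add
      (foldPoint (0, t))
  have heq : ∀ y : ℝ, 0 < y →
      foldPoint (y, t) = foldPoint (0, t) + y • EuclideanSpace.single 0 1 := by
    intro y hy
    ext i
    fin_cases i <;> simp [foldPoint, abs_of_pos hy]
  have hev : (fun y : ℝ => foldPoint (y, t)) =ᶠ[𝓝 x]
      fun y => foldPoint (0, t) + y • EuclideanSpace.single 0 1 := by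
    filter_upwards [lt_mem_nhds hx] with y hy using heq y hy
  have h1 := (hf _ (foldPoint_mem (x, t))).hasFDerivWithinAt
  exact h1.comp_hasDerivAt x (hd.congr_of_eventuallyEq hev)
    (Eventually.of_forall fun y => foldPoint_mem (y, t))

theorem hasDerivAt_foldPoint_snd {f : E2 → ℝ} (hf : DifferentiableOn ℝ f (range (𝓡∂ 2)))
    (x t : ℝ) :
    HasDerivAt (fun t => (f ∘ foldPoint) (x, t))
      (fderivWithin ℝ f (range (𝓡∂ 2)) (foldPoint (x, t)) (EuclideanSpace.single 1 1)) t := by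
  have hd : HasDerivAt (fun t : ℝ => (foldPoint (x, 0) + t • EuclideanSpace.single 1 1 : E2))
      (EuclideanSpace.single 1 1) t := by
    simpa using ((hasDerivAt_id t).smul_const (EuclideanSpace.single (1 : Fin 2) (1 : ℝ))).const_add
      (foldPoint (x, 0))
  have heq : (fun t : ℝ => foldPoint (x, t)) =
      fun t => foldPoint (x, 0) + t • EuclideanSpace.single 1 1 := by
    funext y
    ext i
    fin_cases i <;> simp [foldPoint]
  have h1 := (hf _ (foldPoint_mem (x, t))).hasFDerivWithinAt
  exact h1.comp_hasDerivAt t (heq ▸ hd) (Eventually.of_forall fun y => foldPoint_mem (x, y))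

theorem fderivWithin_eq_zero_of_notMem {f : E2 → ℝ} {K : Set E2} (hK : IsCompact K)
    (hf : ∀ u ∈ range (𝓡∂ 2), u ∉ K → f u = 0) (v : E2) :
    ∀ u ∈ range (𝓡∂ 2), u ∉ K → fderivWithin ℝ f (range (𝓡∂ 2)) u v = 0 := by
  intro u hu huK
  have : f =ᶠ[𝓝[range (𝓡∂ 2)] u] fun _ => 0 := by
    filter_upwards [self_mem_nhdsWithin,
      mem_nhdsWithin_of_mem_nhds (hK.isClosed.isOpen_compl.mem_nhds huK)] with y hy hy'
      using hf y hy hy'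
  rw [this.fderivWithin_eq (hf u hu huK)]
  simp

/-- The map `(x, t) ↦ !₂[x, t]` preserves the volume. -/
theorem measurePreserving_toE2 :
    MeasurePreserving (fun z : ℝ × ℝ => (!₂[z.1, z.2] : E2)) :=
  ((EuclideanSpace.volume_preserving_symm_measurableEquiv_toLp (Fin 2)).symm).comp
    (volume_preserving_finTwoArrow ℝ).symm

theorem measurableEmbedding_toE2 :
    MeasurableEmbedding (fun z : ℝ × ℝ => (!₂[z.1, z.2] : E2)) :=
  (MeasurableEquiv.finTwoArrow.symm.trans (MeasurableEquiv.toLp 2 (Fin 2 → ℝ))).measurableEmbedding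

/-- Green's formula on the half-plane, for the form `F dG` with `F` and `G` merely `C¹`. -/
theorem green_halfPlane {F G : E2 → ℝ} {K L : Set E2} (hK : IsCompact K) (hL : IsCompact L)
    (hF : ContDiffOn ℝ 1 F (range (𝓡∂ 2))) (hG : ContDiffOn ℝ 1 G (range (𝓡∂ 2)))
    (sF : ∀ u ∈ range (𝓡∂ 2), u ∉ K → F u = 0) (sG : ∀ u ∈ range (𝓡∂ 2), u ∉ L → G u = 0) :
    ∫ u in range (𝓡∂ 2),
      (fderivWithin ℝ F (range (𝓡∂ 2)) u (EuclideanSpace.single 0 1)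
          * fderivWithin ℝ G (range (𝓡∂ 2)) u (EuclideanSpace.single 1 1)
        - fderivWithin ℝ F (range (𝓡∂ 2)) u (EuclideanSpace.single 1 1)
          * fderivWithin ℝ G (range (𝓡∂ 2)) u (EuclideanSpace.single 0 1))
      = -∫ t : ℝ, F !₂[0, t]
          * fderivWithin ℝ G (range (𝓡∂ 2)) !₂[0, t] (EuclideanSpace.single 1 1) := by
  have hU : UniqueDiffOn ℝ (range (𝓡∂ 2)) := (𝓡∂ 2).uniqueDiffOn
  have cont : ∀ f : E2 → ℝ, ContinuousOn f (range (𝓡∂ 2)) → Continuous (f ∘ foldPoint) :=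
    fun f hf => hf.comp_continuous continuous_foldPoint foldPoint_mem
  have cderiv : ∀ f : E2 → ℝ, ContDiffOn ℝ 1 f (range (𝓡∂ 2)) → ∀ v : E2,
      Continuous ((fun u => fderivWithin ℝ f (range (𝓡∂ 2)) u v) ∘ foldPoint) :=
    fun f hf v => cont _ ((hf.continuousOn_fderivWithin hU le_rfl).clm_apply continuousOn_const)
  have key := integral_halfPlane (cont F hF.continuousOn) (cderiv F hF (EuclideanSpace.single 0 1))
    (cderiv F hF (EuclideanSpace.single 1 1)) (cont G hG.continuousOn)
    (cderiv G hG (EuclideanSpace.single 0 1)) (cderiv G hG (EuclideanSpace.single 1 1))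
    (hasCompactSupport_comp_foldPoint hK sF)
    (hasCompactSupport_comp_foldPoint hK (fderivWithin_eq_zero_of_notMem hK sF _))
    (hasCompactSupport_comp_foldPoint hK (fderivWithin_eq_zero_of_notMem hK sF _))
    (hasCompactSupport_comp_foldPoint hL (fderivWithin_eq_zero_of_notMem hL sG _))
    (hasCompactSupport_comp_foldPoint hL (fderivWithin_eq_zero_of_notMem hL sG _))
    (fun x t hx => hasDerivAt_foldPoint_fst (hF.differentiableOn one_ne_zero) hx)
    (fun x t => hasDerivAt_foldPoint_snd (hF.differentiableOn one_ne_zero) x t)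
    (fun x t hx => hasDerivAt_foldPoint_fst (hG.differentiableOn one_ne_zero) hx)
    (fun x t => hasDerivAt_foldPoint_snd (hG.differentiableOn one_ne_zero) x t)
  have h0 : ∀ t : ℝ, foldPoint (0, t) = !₂[0, t] := fun t => by simp [foldPoint]
  simp only [Function.comp_apply, h0] at key
  rw [← key, ← measurePreserving_toE2.setIntegral_preimage_emb measurableEmbedding_toE2]
  have hset : (fun z : ℝ × ℝ => (!₂[z.1, z.2] : E2)) ⁻¹' range (𝓡∂ 2) = Ici (0 : ℝ) ×ˢ univ := by
    ext z
    simp only [mem_preimage, mem_range_halfPlane]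
    simp
  -- The boundary line is null, so the closed half-plane may be replaced by the open one.
  have hae : (Ici (0 : ℝ) ×ˢ (univ : Set ℝ) : Set (ℝ × ℝ)) =ᵐ[volume] Ioi (0 : ℝ) ×ˢ univ :=
    Measure.set_prod_ae_eq Ioi_ae_eq_Ici.symm (ae_eq_refl _)
  rw [hset, setIntegral_congr_set hae]
  refine setIntegral_congr_fun (measurableSet_Ioi.prod MeasurableSet.univ) fun z hz => ?_
  have hz0 : (!₂[z.1, z.2] : E2) = foldPoint z := by
    simp [foldPoint, abs_of_pos (show (0 : ℝ) < z.1 from hz.1)]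
  simp only [hz0]

/-! ### Gluing and changing variables for measures given in parametrizations. -/

theorem restrict_iSup_eq_of_restrict_le {ι α : Type*} [MeasurableSpace α] {m : ι → Measure α}
    {S : Set α} (hS : MeasurableSet S) (c : ι) (h : ∀ i, (m i).restrict S ≤ m c) :
    (⨆ i, m i).restrict S = (m c).restrict S := by
  refine le_antisymm ?_ (Measure.restrict_mono le_rfl (le_iSup m c))
  -- A supremum of measures is hard to evaluate on sets, but it is bounded by any common upper
  -- bound. The infinite measure off `S` dominates everything there and disappears on restriction to
  -- `S`.
  have hle : (⨆ i, m i) ≤ m c + (⊤ : Measure α).restrict Sᶜ := by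
    refine iSup_le fun i => ?_
    rw [← Measure.restrict_add_restrict_compl (μ := m i) hS]
    exact add_le_add (h i) (Measure.restrict_mono le_rfl le_top)
  refine (Measure.restrict_mono le_rfl hle).trans ?_
  rw [Measure.restrict_add, Measure.restrict_restrict hS, inter_compl_self,
    Measure.restrict_empty, add_zero]

section ParametrizedMeasure

variable {E M : Type*} [TopologicalSpace E] [MeasurableSpace E] [BorelSpace E]
  [TopologicalSpace M] [MeasurableSpace M] [BorelSpace M]

theorem measurableSet_inter_preimage_of_continuousOn {s : E → M} {T : Set E}
    (hT : MeasurableSet T) (hs : ContinuousOn s T) {B : Set M} (hB : MeasurableSet B) :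
    MeasurableSet (T ∩ s ⁻¹' B) := by
  rw [← Subtype.image_preimage_coe]
  exact hT.subtype_image (hs.domRestrict.measurable hB)

theorem map_withDensity_apply {μ : Measure E} [SFinite μ] {s : E → M} {T : Set E}
    (hT : MeasurableSet T) (hs : ContinuousOn s T) (ρ : E → ENNReal) {B : Set M}
    (hB : MeasurableSet B) :
    Measure.map s ((μ.restrict T).withDensity ρ) B = ∫⁻ u in T ∩ s ⁻¹' B, ρ u ∂μ := by
  have hae : AEMeasurable s ((μ.restrict T).withDensity ρ) :=
    (hs.aemeasurable hT).mono_ac (withDensity_absolutelyContinuous _ _)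
  rw [Measure.map_apply_of_aemeasurable hae hB, withDensity_apply' _ _,
    Measure.restrict_restrict' hT, inter_comm]

/-- Integration with respect to a measure given by a density in a parametrization `s : T → M`
with continuous inverse `r : R → T`. -/
theorem integral_map_withDensity {μ : Measure E} [SFinite μ] {s : E → M} {r : M → E} {T : Set E}
    {R : Set M} (hT : MeasurableSet T) (hR : MeasurableSet R) (hs : ContinuousOn s T)
    (hr : ContinuousOn r R) (hsR : MapsTo s T R) (hrT : MapsTo r R T) (hsr : ∀ p ∈ R, s (r p) = p)
    {w : E → ℝ} (hw : ContinuousOn w T) (hw0 : ∀ u, 0 ≤ w u)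
    {Ψ : M → ℝ} (hΨ : ContinuousOn (fun u => Ψ (s u)) T) :
    (IntegrableOn (fun u => w u * Ψ (s u)) T μ →
      Integrable Ψ (Measure.map s ((μ.restrict T).withDensity fun u => ENNReal.ofReal (w u)))) ∧
    ∫ p, Ψ p ∂(Measure.map s ((μ.restrict T).withDensity fun u => ENNReal.ofReal (w u)))
      = ∫ u in T, w u * Ψ (s u) ∂μ := by
  set ν := (μ.restrict T).withDensity fun u => ENNReal.ofReal (w u) with hν
  have hac : ν ≪ μ.restrict T := withDensity_absolutelyContinuous _ _
  have hae : AEMeasurable s ν := (hs.aemeasurable hT).mono_ac hac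
  have hwm : AEMeasurable (fun u => ENNReal.ofReal (w u)) (μ.restrict T) :=
    (hw.aemeasurable hT).ennreal_ofReal
  have hΨR : ContinuousOn Ψ R :=
    (hΨ.comp hr hrT).congr fun p hp => by simp [hsr p hp]
  -- The image measure is carried by `R`, where `Ψ` is continuous; no regularity of `Ψ` elsewhere is
  -- needed.
  have hmapR : (Measure.map s ν).restrict R = Measure.map s ν := by
    refine Measure.restrict_eq_self_of_ae_mem ?_
    refine (ae_map_iff hae hR).mpr ?_
    exact hac.ae_le ((ae_restrict_mem hT).mono fun u hu => hsR hu)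
  have hΨm : AEStronglyMeasurable Ψ (Measure.map s ν) := by
    rw [← hmapR]
    exact hΨR.aestronglyMeasurable hR
  have hlt : ∀ᵐ u ∂(μ.restrict T), ENNReal.ofReal (w u) < ⊤ :=
    Eventually.of_forall fun u => ENNReal.ofReal_lt_top
  constructor
  · intro hi
    rw [integrable_map_measure hΨm hae, hν,
      integrable_withDensity_iff_integrable_smul₀' hwm hlt]
    simpa [ENNReal.toReal_ofReal, hw0, IntegrableOn] using hi
  · rw [integral_map hae hΨm, hν, integral_withDensity_eq_integral_toReal_smul₀ hwm hlt]
    simp [ENNReal.toReal_ofReal, hw0]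

end ParametrizedMeasure

section ChangeOfVariables

variable {E M : Type*} [NormedAddCommGroup E] [NormedSpace ℝ E] [FiniteDimensional ℝ E]
  [MeasurableSpace E] [BorelSpace E] [TopologicalSpace M] [MeasurableSpace M] [BorelSpace M]

/-- Change of variables along the transition map `ψ`. An inequality is enough for the gluing lemma,
so it suffices that `ψ` maps into the relevant part of `T`. -/
theorem restrict_map_withDensity_le {μ : Measure E} [μ.IsAddHaarMeasure] {s s' : E → M}
    {T T' : Set E} (hT : MeasurableSet T) (hT' : MeasurableSet T') (hs : ContinuousOn s T)
    (hs' : ContinuousOn s' T') (hinj : InjOn s' T') {w w' : E → ℝ} {S : Set M}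
    (hS : MeasurableSet S) {ψ : E → E} {ψ' : E → E →L[ℝ] E}
    (hψT : ∀ u ∈ T', s' u ∈ S → ψ u ∈ T) (hψs : ∀ u ∈ T', s' u ∈ S → s (ψ u) = s' u)
    (hψ' : ∀ u ∈ T', s' u ∈ S → HasFDerivWithinAt ψ (ψ' u) T' u)
    (hw : ∀ u ∈ T', s' u ∈ S → w' u = |(ψ' u).det| * w (ψ u)) :
    (Measure.map s' ((μ.restrict T').withDensity fun u => ENNReal.ofReal (w' u))).restrict S
      ≤ Measure.map s ((μ.restrict T).withDensity fun u => ENNReal.ofReal (w u)) := by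
  refine Measure.le_iff.mpr fun B hB => ?_
  rw [Measure.restrict_apply hB, map_withDensity_apply hT' hs' _ (hB.inter hS),
    map_withDensity_apply hT hs _ hB]
  set A := T' ∩ s' ⁻¹' (B ∩ S) with hA
  have hAm : MeasurableSet A := measurableSet_inter_preimage_of_continuousOn hT' hs' (hB.inter hS)
  have hψA : ∀ u ∈ A, HasFDerivWithinAt ψ (ψ' u) A u :=
    fun u hu => (hψ' u hu.1 hu.2.2).mono inter_subset_left
  have hinjA : InjOn ψ A := fun u hu v hv huv => hinj hu.1 hv.1 (by
    rw [← hψs u hu.1 hu.2.2, ← hψs v hv.1 hv.2.2, huv])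
  calc ∫⁻ u in A, ENNReal.ofReal (w' u) ∂μ
      = ∫⁻ u in A, ENNReal.ofReal |(ψ' u).det| * ENNReal.ofReal (w (ψ u)) ∂μ := by
        refine setLIntegral_congr_fun hAm fun u hu => ?_
        rw [hw u hu.1 hu.2.2, ENNReal.ofReal_mul (abs_nonneg _)]
    _ = ∫⁻ u in ψ '' A, ENNReal.ofReal (w u) ∂μ :=
        (lintegral_image_eq_lintegral_abs_det_fderiv_mul μ hAm hψA hinjA
          fun u => ENNReal.ofReal (w u)).symm
    _ ≤ ∫⁻ u in T ∩ s ⁻¹' B, ENNReal.ofReal (w u) ∂μ := by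
        refine lintegral_mono_set ?_
        rintro _ ⟨u, hu, rfl⟩
        refine ⟨hψT u hu.1 hu.2.2, ?_⟩
        rw [mem_preimage, hψs u hu.1 hu.2.2]
        exact hu.2.1

end ChangeOfVariables

/-! ### Vector algebra in three-space: cross products and oriented frames. -/

theorem inner_E3 (v w : E3) : inner ℝ v w = v 0 * w 0 + v 1 * w 1 + v 2 * w 2 := by
  simp [PiLp.inner_apply, Fin.sum_univ_three, mul_comm]

theorem cross_zero' (v w : E3) : cross v w 0 = v 1 * w 2 - v 2 * w 1 := by
  simp [cross, cross_apply]

theorem cross_one' (v w : E3) : cross v w 1 = v 2 * w 0 - v 0 * w 2 := by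
  simp [cross, cross_apply]

theorem cross_two' (v w : E3) : cross v w 2 = v 0 * w 1 - v 1 * w 0 := by
  simp [cross, cross_apply]

theorem continuous_cross : Continuous fun z : E3 × E3 => cross z.1 z.2 := by
  refine (PiLp.continuous_toLp 2 _).comp (continuous_pi fun i => ?_)
  fin_cases i <;> simp [cross_apply] <;> fun_prop

theorem cross_combination (v w : E3) (a b c d : ℝ) :
    cross (a • v + b • w) (c • v + d • w) = (a * d - b * c) • cross v w := by
  ext i
  fin_cases i <;> simp [cross_apply, cross] <;> ring

theorem cross_ne_zero {v w : E3} (h : ∀ a b : ℝ, a • v + b • w = 0 → a = 0 ∧ b = 0) :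
    cross v w ≠ 0 := by
  intro h0
  have c0 : v 1 * w 2 - v 2 * w 1 = 0 := by rw [← cross_zero', h0]; rfl
  have c1 : v 2 * w 0 - v 0 * w 2 = 0 := by rw [← cross_one', h0]; rfl
  have c2 : v 0 * w 1 - v 1 * w 0 = 0 := by rw [← cross_two', h0]; rfl
  -- The coefficients come from `(v × w) × v = (v·v) w - (v·w) v`, which vanishes when `v × w = 0`.
  have h1 := h (-inner ℝ v w) (inner ℝ v v) (by
    rw [inner_E3, inner_E3]
    ext i
    fin_cases i <;> simp
    · linear_combination (v 2) * c1 - (v 1) * c2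
    · linear_combination (v 0) * c2 - (v 2) * c0
    · linear_combination (v 1) * c0 - (v 0) * c1)
  have hv : v = 0 := inner_self_eq_zero.mp h1.2
  exact one_ne_zero (h 1 0 (by simp [hv])).1

section Frame

variable {P Q n e₀ e₁ : E3} (hP : ‖P‖ = 1) (hQ : ‖Q‖ = 1) (hPQ : inner ℝ P Q = 0)
  (hn : cross P Q = n)

include hP hQ hPQ hn in
-- `P`, `Q` and `P × Q` form an orthonormal basis. In coordinates this is the expansion of `|P × Q|²
-- v` along `P`, `Q`, `P × Q` with Gram coefficients: the multipliers reduce the Gram matrix of `(P,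
-- Q)` to the identity, and `hv` removes the normal component.
theorem eq_frame_combination {v : E3} (hv : inner ℝ n v = 0) :
    v = (inner ℝ P v : ℝ) • P + (inner ℝ Q v : ℝ) • Q := by
  have hP' : P 0 * P 0 + P 1 * P 1 + P 2 * P 2 = 1 := by
    rw [← inner_E3, real_inner_self_eq_norm_sq, hP, one_pow]
  have hQ' : Q 0 * Q 0 + Q 1 * Q 1 + Q 2 * Q 2 = 1 := by
    rw [← inner_E3, real_inner_self_eq_norm_sq, hQ, one_pow]
  rw [inner_E3] at hPQ hv
  subst hn
  rw [cross_zero', cross_one', cross_two'] at hv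
  set Pv := P 0 * v 0 + P 1 * v 1 + P 2 * v 2 with hPv
  set Qv := Q 0 * v 0 + Q 1 * v 1 + Q 2 * v 2 with hQv
  ext i
  simp only [inner_E3, PiLp.add_apply, PiLp.smul_apply, smul_eq_mul, ← hPv, ← hQv]
  fin_cases i <;> simp only [Fin.zero_eta, Fin.mk_one, Fin.reduceFinMk, Fin.isValue]
  · linear_combination (Qv * Q 0 - v 0 * (Q 0 * Q 0 + Q 1 * Q 1 + Q 2 * Q 2)) * hP'
      + (Pv * P 0 - v 0) * hQ'
      + (v 0 * (P 0 * Q 0 + P 1 * Q 1 + P 2 * Q 2) - Qv * P 0 - Pv * Q 0) * hPQ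
      + (P 1 * Q 2 - P 2 * Q 1) * hv
  · linear_combination (Qv * Q 1 - v 1 * (Q 0 * Q 0 + Q 1 * Q 1 + Q 2 * Q 2)) * hP'
      + (Pv * P 1 - v 1) * hQ'
      + (v 1 * (P 0 * Q 0 + P 1 * Q 1 + P 2 * Q 2) - Qv * P 1 - Pv * Q 1) * hPQ
      + (P 2 * Q 0 - P 0 * Q 2) * hv
  · linear_combination (Qv * Q 2 - v 2 * (Q 0 * Q 0 + Q 1 * Q 1 + Q 2 * Q 2)) * hP'
      + (Pv * P 2 - v 2) * hQ'
      + (v 2 * (P 0 * Q 0 + P 1 * Q 1 + P 2 * Q 2) - Qv * P 2 - Pv * Q 2) * hPQ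
      + (P 0 * Q 1 - P 1 * Q 0) * hv

include hP hQ hPQ hn in
theorem norm_frame_normal : ‖n‖ = 1 := by
  have hP' : P 0 * P 0 + P 1 * P 1 + P 2 * P 2 = 1 := by
    rw [← inner_E3, real_inner_self_eq_norm_sq, hP, one_pow]
  have hQ' : Q 0 * Q 0 + Q 1 * Q 1 + Q 2 * Q 2 = 1 := by
    rw [← inner_E3, real_inner_self_eq_norm_sq, hQ, one_pow]
  have h2 : ‖n‖ ^ 2 = 1 := by
    rw [← real_inner_self_eq_norm_sq, inner_E3, ← hn, cross_zero', cross_one', cross_two']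
    rw [inner_E3] at hPQ
    linear_combination (Q 0 * Q 0 + Q 1 * Q 1 + Q 2 * Q 2) * hP' + hQ'
      - (P 0 * Q 0 + P 1 * Q 1 + P 2 * Q 2) * hPQ
  exact (pow_eq_one_iff_of_nonneg (norm_nonneg _) two_ne_zero).mp h2

include hP hQ hPQ hn in
theorem cross_eq_smul_normal (h₀ : inner ℝ n e₀ = 0) (h₁ : inner ℝ n e₁ = 0) :
    cross e₀ e₁ = (inner ℝ n (cross e₀ e₁) : ℝ) • n := by
  have hc : cross e₀ e₁ = (inner ℝ P e₀ * inner ℝ Q e₁ - inner ℝ Q e₀ * inner ℝ P e₁ : ℝ) • n := by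
    conv_lhs => rw [eq_frame_combination hP hQ hPQ hn h₀, eq_frame_combination hP hQ hPQ hn h₁]
    rw [cross_combination, hn]
  rw [hc, inner_smul_right, real_inner_self_eq_norm_sq, norm_frame_normal hP hQ hPQ hn]
  simp

include hP hQ hPQ hn in
theorem abs_inner_normal_cross (h₀ : inner ℝ n e₀ = 0) (h₁ : inner ℝ n e₁ = 0) :
    |(inner ℝ n (cross e₀ e₁) : ℝ)| = ‖cross e₀ e₁‖ := by
  conv_rhs => rw [cross_eq_smul_normal hP hQ hPQ hn h₀ h₁, norm_smul,
    norm_frame_normal hP hQ hPQ hn, mul_one, Real.norm_eq_abs]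

include hP hQ hPQ hn in
/-- The value of the alternating form `α ∧ β` on the frame `(P, Q)`, scaled by the area element. -/
theorem norm_cross_mul_wedge (h₀ : inner ℝ n e₀ = 0) (h₁ : inner ℝ n e₁ = 0)
    (α β : E3 →L[ℝ] ℝ) :
    ‖cross e₀ e₁‖ * (α P * β Q - α Q * β P)
      = (SignType.sign (inner ℝ n (cross e₀ e₁) : ℝ) : ℝ) * (α e₀ * β e₁ - α e₁ * β e₀) := by
  -- The oriented area of `(e₀, e₁)` is the determinant of their coordinates in `(P, Q)`; the same
  -- determinant relates the values of `α ∧ β` on the two pairs in `hω`.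
  have hJ : (inner ℝ n (cross e₀ e₁) : ℝ)
      = inner ℝ P e₀ * inner ℝ Q e₁ - inner ℝ Q e₀ * inner ℝ P e₁ := by
    conv_lhs => rw [eq_frame_combination hP hQ hPQ hn h₀, eq_frame_combination hP hQ hPQ hn h₁]
    rw [cross_combination, hn, inner_smul_right, real_inner_self_eq_norm_sq,
      norm_frame_normal hP hQ hPQ hn]
    simp
  have hω : α e₀ * β e₁ - α e₁ * β e₀
      = (inner ℝ n (cross e₀ e₁) : ℝ) * (α P * β Q - α Q * β P) := by
    rw [hJ]
    conv_lhs => rw [eq_frame_combination hP hQ hPQ hn h₀, eq_frame_combination hP hQ hPQ hn h₁]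
    simp only [map_add, map_smul, smul_eq_mul]
    ring
  rw [hω, ← mul_assoc, sign_mul_self, abs_inner_normal_cross hP hQ hPQ hn h₀ h₁]

end Frame

/-- The oriented unit tangent only depends on the tangent line and the inward direction. -/
theorem oriented_tangent_eq {n τ d : E3} {a b k : ℝ} (ha : a ≠ 0) (hb : 0 < b) :
    ((SignType.sign (inner ℝ n (cross (a • τ) (b • d + k • τ)) : ℝ) : ℝ) * ‖a • τ‖⁻¹) • a • τ
      = ((SignType.sign (inner ℝ n (cross τ d) : ℝ) : ℝ) * ‖τ‖⁻¹) • τ := by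
  -- The cross product is multiplied by `a * b`. As `b > 0`, only the sign of `a` enters; it cancels
  -- against the sign of `a` in `a • τ`, and `|a|` cancels in the normalization.
  have h := cross_combination τ d a 0 k b
  rw [zero_smul, add_zero, zero_mul, sub_zero, add_comm (k • τ)] at h
  rw [h, inner_smul_right, sign_mul, sign_mul, sign_pos hb, mul_one, norm_smul, smul_smul,
    Real.norm_eq_abs]
  congr 1
  rcases lt_or_gt_of_ne ha with h | h
  · rw [sign_neg h, abs_of_neg h, SignType.coe_mul, SignType.coe_neg, SignType.coe_one]
    field_simp
  · rw [sign_pos h, abs_of_pos h, SignType.coe_mul, SignType.coe_one]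
    field_simp

/-! ### Charts, local parametrizations and changes of coordinates up to the boundary. -/

theorem measurableSet_range_halfPlane : MeasurableSet (range (𝓡∂ 2)) :=
  (𝓡∂ 2).isClosed_range.measurableSet

theorem E2_eq_smul_add_smul (v : E2) :
    v = v 0 • EuclideanSpace.single 0 1 + v 1 • EuclideanSpace.single 1 1 := by
  ext i
  fin_cases i <;> simp

theorem det_E2 (L : E2 →L[ℝ] E2) :
    L.det = L (EuclideanSpace.single 0 1) 0 * L (EuclideanSpace.single 1 1) 1
      - L (EuclideanSpace.single 0 1) 1 * L (EuclideanSpace.single 1 1) 0 := by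
  rw [ContinuousLinearMap.det,
    ← LinearMap.det_toMatrix (EuclideanSpace.basisFun (Fin 2) ℝ).toBasis, Matrix.det_fin_two]
  simp [LinearMap.toMatrix_apply]
  ring

section Charts

variable {M : Type*} [TopologicalSpace M] [ChartedSpace (EuclideanHalfSpace 2) M]

theorem isOpen_chart_source (c : M) : IsOpen (extChartAt (𝓡∂ 2) c).source :=
  isOpen_extChartAt_source c

theorem measurableSet_chart_target (c : M) : MeasurableSet (extChartAt (𝓡∂ 2) c).target := by
  rw [extChartAt_target]
  exact ((chartAt _ c).open_target.preimage (𝓡∂ 2).continuous_symm).measurableSet.inter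
    measurableSet_range_halfPlane

theorem chart_target_subset (c : M) : (extChartAt (𝓡∂ 2) c).target ⊆ range (𝓡∂ 2) :=
  extChartAt_target_subset_range c

theorem chart_mem_range (c p : M) : extChartAt (𝓡∂ 2) c p ∈ range (𝓡∂ 2) := by
  rw [extChartAt_coe]
  exact mem_range_self _

theorem nhdsWithin_chart_target {c : M} {u : E2} (hu : u ∈ (extChartAt (𝓡∂ 2) c).target) :
    𝓝[(extChartAt (𝓡∂ 2) c).target] u = 𝓝[range (𝓡∂ 2)] u :=
  le_antisymm (nhdsWithin_mono _ (chart_target_subset c))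
    (nhdsWithin_le_of_mem (extChartAt_target_mem_nhdsWithin_of_mem hu))

/-- The differential of the local parametrization at `c`. -/
noncomputable def paramDeriv (X : M → E3) (c : M) (u : E2) : E2 →L[ℝ] E3 :=
  fderivWithin ℝ (localParam X c) (range (𝓡∂ 2)) u

theorem partialParam_eq (X : M → E3) (c : M) (i : Fin 2) (u : E2) :
    partialParam X c i u = paramDeriv X c u (EuclideanSpace.single i 1) := rfl

/-- The change of coordinates from the chart at `c'` to the chart at `c`. -/
noncomputable def transition (c c' : M) (u : E2) : E2 :=
  extChartAt (𝓡∂ 2) c ((extChartAt (𝓡∂ 2) c').symm u)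

/-- The differential of the change of coordinates from the chart at `c'` to the chart at `c`. -/
noncomputable def transitionDeriv (c c' : M) (u : E2) : E2 →L[ℝ] E2 :=
  fderivWithin ℝ (transition c c') (range (𝓡∂ 2)) u

variable [IsManifold (𝓡∂ 2) ∞ M]

theorem contDiffOn_localParam {X : M → E3} (hX : ContMDiff (𝓡∂ 2) 𝓘(ℝ, E3) ∞ X) (c : M) :
    ContDiffOn ℝ ∞ (localParam X c) (extChartAt (𝓡∂ 2) c).target :=
  contMDiffOn_iff_contDiffOn.mp (hX.comp_contMDiffOn (contMDiffOn_extChartAt_symm c))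

theorem hasFDerivWithinAt_localParam {X : M → E3} (hX : ContMDiff (𝓡∂ 2) 𝓘(ℝ, E3) ∞ X) {c : M}
    {u : E2} (hu : u ∈ (extChartAt (𝓡∂ 2) c).target) :
    HasFDerivWithinAt (localParam X c) (paramDeriv X c u) (range (𝓡∂ 2)) u := by
  have h := ((contDiffOn_localParam hX c).differentiableOn (by simp)) u hu
  exact (h.mono_of_mem_nhdsWithin (extChartAt_target_mem_nhdsWithin_of_mem hu)).hasFDerivWithinAt

theorem continuousOn_paramDeriv {X : M → E3} (hX : ContMDiff (𝓡∂ 2) 𝓘(ℝ, E3) ∞ X) (c : M) :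
    ContinuousOn (paramDeriv X c) (extChartAt (𝓡∂ 2) c).target := by
  refine ((contDiffOn_localParam hX c).continuousOn_fderivWithin
    (uniqueDiffOn_extChartAt_target c) (by simp)).congr fun u hu => ?_
  exact (hasFDerivWithinAt_localParam hX hu |>.mono (chart_target_subset c)).fderivWithin
    (uniqueDiffOn_extChartAt_target c u hu) |>.symm

theorem continuousOn_partialParam {X : M → E3} (hX : ContMDiff (𝓡∂ 2) 𝓘(ℝ, E3) ∞ X) (c : M)
    (i : Fin 2) : ContinuousOn (partialParam X c i) (extChartAt (𝓡∂ 2) c).target :=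
  (continuousOn_paramDeriv hX c).clm_apply continuousOn_const

theorem inner_normal_paramDeriv {X N : M → E3} (hX : ContMDiff (𝓡∂ 2) 𝓘(ℝ, E3) ∞ X)
    (hN : IsUnitNormal X N) {c : M} {u : E2} (hu : u ∈ (extChartAt (𝓡∂ 2) c).target) (v : E2) :
    inner ℝ (N ((extChartAt (𝓡∂ 2) c).symm u)) (paramDeriv X c u v) = 0 := by
  have : IsManifold (𝓡∂ 2) 1 M := IsManifold.of_le (n := ∞) (by simp)
  have h1 := (mdifferentiableWithinAt_extChartAt_symm (I := 𝓡∂ 2) hu).hasMFDerivWithinAt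
  have h2 := ((hX.mdifferentiable (by simp)) ((extChartAt (𝓡∂ 2) c).symm u)).hasMFDerivAt
  let A : E2 →L[ℝ] E2 := mfderivWithin 𝓘(ℝ, E2) (𝓡∂ 2) (extChartAt (𝓡∂ 2) c).symm (range (𝓡∂ 2)) u
  let B : E2 →L[ℝ] E3 := mfderiv (𝓡∂ 2) 𝓘(ℝ, E3) X ((extChartAt (𝓡∂ 2) c).symm u)
  have h3 : HasFDerivWithinAt (localParam X c) (B.comp A) (range (𝓡∂ 2)) u :=
    (h2.comp_hasMFDerivWithinAt u h1).hasFDerivWithinAt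
  have h4 : paramDeriv X c u = B.comp A :=
    h3.fderivWithin ((𝓡∂ 2).uniqueDiffOn u (chart_target_subset c hu))
  rw [h4]
  exact hN.inner_eq_zero _ (A v)

/-- In the charts supplied by the immersion, `X` reads as an inclusion `u ↦ (u, 0)`. Projecting to
the first factor and then changing to the chart at `c` gives a differentiable left inverse of the
local parametrization, so the chain rule gives a left inverse of its differential. -/
theorem paramDeriv_injective {X : M → E3} (hX : IsImmersion (𝓡∂ 2) 𝓘(ℝ, E3) ∞ X) {c : M} {u : E2}
    (hu : u ∈ (extChartAt (𝓡∂ 2) c).target) : Function.Injective (paramDeriv X c u) := by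
  set p := (extChartAt (𝓡∂ 2) c).symm u with hp
  have hpS : p ∈ (extChartAt (𝓡∂ 2) c).source := (extChartAt (𝓡∂ 2) c).map_target hu
  have h := hX.isImmersionAt p
  set D := h.domChart with hD
  have hpD : p ∈ D.source := h.mem_domChart_source
  have hκ : ContDiffAt ℝ ∞ (h.codChart.extend 𝓘(ℝ, E3)) (X p) :=
    contMDiffAt_iff_contDiffAt.mp
      (h.codChart.contMDiffAt_extend h.codChart_mem_maximalAtlas h.mem_codChart_source)
  have hΘ := (𝓡∂ 2).contDiffWithinAt_extendCoordChange' h.domChart_mem_maximalAtlas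
    (IsManifold.chart_mem_maximalAtlas (I := 𝓡∂ 2) (n := ∞) c) hpD
    (by rwa [← extChartAt_source (𝓡∂ 2)])
  set g : E3 → E2 := fun y => (h.equiv.symm (h.codChart.extend 𝓘(ℝ, E3) y)).1 with hg
  have hgφ : ∀ᶠ v in 𝓝[range (𝓡∂ 2)] u, g (localParam X c v)
      = D.extend (𝓡∂ 2) ((extChartAt (𝓡∂ 2) c).symm v) := by
    have hev : ∀ᶠ v in 𝓝[range (𝓡∂ 2)] u, (extChartAt (𝓡∂ 2) c).symm v ∈ D.source := by
      rw [← nhdsWithin_chart_target hu]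
      exact (continuousOn_extChartAt_symm c u hu) (D.open_source.mem_nhds hpD)
    filter_upwards [hev] with v hv
    have h1 := h.writtenInCharts
      ((D.extend (𝓡∂ 2)).map_source (by rwa [D.extend_source]) :
        D.extend (𝓡∂ 2) ((extChartAt (𝓡∂ 2) c).symm v) ∈ _)
    simp only [Function.comp_apply] at h1
    rw [(D.extend (𝓡∂ 2)).left_inv (by rwa [D.extend_source])] at h1
    rw [hg]
    simp only [localParam]
    rw [h1]
    simp
  have hgd : DifferentiableAt ℝ g (localParam X c u) := by
    have := hκ.differentiableAt (by simp)
    have h2 : DifferentiableAt ℝ (fun y => h.equiv.symm (h.codChart.extend 𝓘(ℝ, E3) y)) (X p) :=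
      h.equiv.symm.differentiable.differentiableAt.comp _ this
    exact h2.fst
  have hφ := hasFDerivWithinAt_localParam hX.contMDiff hu
  have hgφ' := hgd.hasFDerivAt.comp_hasFDerivWithinAt u hφ
  have hgu : (g ∘ localParam X c) u = D.extend (𝓡∂ 2) p :=
    hgφ.self_of_nhdsWithin (chart_target_subset c hu)
  have hΘd := (hΘ.differentiableWithinAt (by simp)).hasFDerivWithinAt
  rw [← hgu] at hΘd
  have htend : Tendsto (g ∘ localParam X c) (𝓝[range (𝓡∂ 2)] u)
      (𝓝[range (𝓡∂ 2)] ((g ∘ localParam X c) u)) := by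
    refine tendsto_nhdsWithin_iff.mpr ⟨hgφ'.continuousWithinAt, ?_⟩
    filter_upwards [hgφ] with v hv
    rw [Function.comp_apply, hv, D.extend_coe]
    exact mem_range_self _
  have hcomp := hΘd.comp_of_tendsto u hgφ' htend
  have hid : (fun v => v) =ᶠ[𝓝[range (𝓡∂ 2)] u]
      (𝓡∂ 2).extendCoordChange D (chartAt (EuclideanHalfSpace 2) c) ∘ g ∘ localParam X c := by
    have hev : ∀ᶠ v in 𝓝[range (𝓡∂ 2)] u, (extChartAt (𝓡∂ 2) c).symm v ∈ D.source := by
      rw [← nhdsWithin_chart_target hu]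
      exact (continuousOn_extChartAt_symm c u hu) (D.open_source.mem_nhds hpD)
    filter_upwards [hgφ, hev, extChartAt_target_mem_nhdsWithin_of_mem hu] with v hv hvD hvT
    have e1 : (D.extend (𝓡∂ 2)).symm (D.extend (𝓡∂ 2) ((extChartAt (𝓡∂ 2) c).symm v))
        = (extChartAt (𝓡∂ 2) c).symm v :=
      (D.extend (𝓡∂ 2)).left_inv (by rwa [D.extend_source])
    rw [Function.comp_apply, Function.comp_apply, hv, PartialEquiv.coe_trans, Function.comp_apply,
      e1]
    exact ((extChartAt (𝓡∂ 2) c).right_inv hvT).symm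
  have hid' := hcomp.congr_of_eventuallyEq hid
    (hid.self_of_nhdsWithin (chart_target_subset c hu))
  have hud := (𝓡∂ 2).uniqueDiffOn u (chart_target_subset c hu)
  have heq := (hid'.fderivWithin hud).symm.trans ((hasFDerivWithinAt_id u _).fderivWithin hud)
  refine fun v w hvw => ?_
  have hv := congrArg (fun L : E2 →L[ℝ] E2 => L v) heq
  have hw := congrArg (fun L : E2 →L[ℝ] E2 => L w) heq
  simp only [ContinuousLinearMap.comp_apply, ContinuousLinearMap.id_apply] at hv hw
  rw [← hv, ← hw, hvw]

variable {c c' : M} {u : E2}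

omit [IsManifold (𝓡∂ 2) ∞ M] in
theorem transition_mem (hS : (extChartAt (𝓡∂ 2) c').symm u ∈ (extChartAt (𝓡∂ 2) c).source) :
    transition c c' u ∈ (extChartAt (𝓡∂ 2) c).target :=
  (extChartAt (𝓡∂ 2) c).map_source hS

omit [IsManifold (𝓡∂ 2) ∞ M] in
theorem symm_transition (hS : (extChartAt (𝓡∂ 2) c').symm u ∈ (extChartAt (𝓡∂ 2) c).source) :
    (extChartAt (𝓡∂ 2) c).symm (transition c c' u) = (extChartAt (𝓡∂ 2) c').symm u :=
  (extChartAt (𝓡∂ 2) c).left_inv hS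

omit [IsManifold (𝓡∂ 2) ∞ M] in
theorem transition_transition (hu : u ∈ (extChartAt (𝓡∂ 2) c').target)
    (hS : (extChartAt (𝓡∂ 2) c').symm u ∈ (extChartAt (𝓡∂ 2) c).source) :
    transition c' c (transition c c' u) = u := by
  rw [transition, symm_transition hS, (extChartAt (𝓡∂ 2) c').right_inv hu]

omit [IsManifold (𝓡∂ 2) ∞ M] in
theorem eventually_symm_mem_source (hu : u ∈ (extChartAt (𝓡∂ 2) c').target)
    (hS : (extChartAt (𝓡∂ 2) c').symm u ∈ (extChartAt (𝓡∂ 2) c).source) :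
    ∀ᶠ v in 𝓝[range (𝓡∂ 2)] u,
      (extChartAt (𝓡∂ 2) c').symm v ∈ (extChartAt (𝓡∂ 2) c).source := by
  rw [← nhdsWithin_chart_target hu]
  exact (continuousOn_extChartAt_symm c' u hu) ((isOpen_chart_source c).mem_nhds hS)

theorem hasFDerivWithinAt_transition (hu : u ∈ (extChartAt (𝓡∂ 2) c').target)
    (hS : (extChartAt (𝓡∂ 2) c').symm u ∈ (extChartAt (𝓡∂ 2) c).source) :
    HasFDerivWithinAt (transition c c') (transitionDeriv c c' u) (range (𝓡∂ 2)) u := by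
  have h := contDiffWithinAt_ext_coord_change (I := 𝓡∂ 2) (n := ∞) c c' (y := u) (by
    rw [PartialEquiv.trans_source]
    exact ⟨hu, hS⟩)
  exact (h.differentiableWithinAt (by simp)).hasFDerivWithinAt

theorem paramDeriv_transition {X : M → E3} (hX : ContMDiff (𝓡∂ 2) 𝓘(ℝ, E3) ∞ X)
    (hu : u ∈ (extChartAt (𝓡∂ 2) c').target)
    (hS : (extChartAt (𝓡∂ 2) c').symm u ∈ (extChartAt (𝓡∂ 2) c).source) :
    paramDeriv X c' u = (paramDeriv X c (transition c c' u)).comp (transitionDeriv c c' u) := by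
  have h := (hasFDerivWithinAt_localParam hX (transition_mem hS)).comp u
    (hasFDerivWithinAt_transition hu hS) (fun v _ => chart_mem_range c _)
  have hev : localParam X c' =ᶠ[𝓝[range (𝓡∂ 2)] u] localParam X c ∘ transition c c' := by
    filter_upwards [eventually_symm_mem_source hu hS] with v hv
    rw [Function.comp_apply, localParam, localParam, symm_transition hv]
  exact (h.congr_of_eventuallyEq hev
    (hev.self_of_nhdsWithin (chart_target_subset c' hu))).fderivWithin
    ((𝓡∂ 2).uniqueDiffOn u (chart_target_subset c' hu))

theorem transitionDeriv_comp (hu : u ∈ (extChartAt (𝓡∂ 2) c').target)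
    (hS : (extChartAt (𝓡∂ 2) c').symm u ∈ (extChartAt (𝓡∂ 2) c).source) (v : E2) :
    transitionDeriv c' c (transition c c' u) (transitionDeriv c c' u v) = v := by
  have hS' : (extChartAt (𝓡∂ 2) c).symm (transition c c' u) ∈ (extChartAt (𝓡∂ 2) c').source := by
    rw [symm_transition hS]
    exact (extChartAt (𝓡∂ 2) c').map_target hu
  have h := (hasFDerivWithinAt_transition (transition_mem hS) hS').comp u
    (hasFDerivWithinAt_transition hu hS) (fun v _ => chart_mem_range c _)
  have hev : (fun v => v) =ᶠ[𝓝[range (𝓡∂ 2)] u] transition c' c ∘ transition c c' := by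
    filter_upwards [eventually_symm_mem_source hu hS,
      extChartAt_target_mem_nhdsWithin_of_mem hu] with v hv hvT
    rw [Function.comp_apply, transition_transition hvT hv]
  have hud := (𝓡∂ 2).uniqueDiffOn u (chart_target_subset c' hu)
  have h' := h.congr_of_eventuallyEq hev (hev.self_of_nhdsWithin (chart_target_subset c' hu))
  have heq := (h'.fderivWithin hud).symm.trans ((hasFDerivWithinAt_id u _).fderivWithin hud)
  exact congrArg (fun L : E2 →L[ℝ] E2 => L v) heq

/-- Where a change of coordinates takes a value on the boundary line, its differential maps
vectors pointing into the half-plane to such vectors. -/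
theorem transitionDeriv_nonneg (hu : u ∈ (extChartAt (𝓡∂ 2) c').target)
    (hS : (extChartAt (𝓡∂ 2) c').symm u ∈ (extChartAt (𝓡∂ 2) c).source)
    (h0 : transition c c' u 0 = 0) {v : E2}
    (hv : ∃ᶠ t : ℝ in 𝓝[>] 0, u + t • v ∈ range (𝓡∂ 2)) :
    0 ≤ transitionDeriv c c' u v 0 := by
  have hd := (EuclideanSpace.proj (𝕜 := ℝ) (0 : Fin 2)).hasFDerivAt.comp_hasFDerivWithinAt u
    (hasFDerivWithinAt_transition hu hS)
  -- The zeroth coordinate of the transition is nonnegative and vanishes at `u`, so `u` is a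
  -- minimum; its derivative is then nonnegative on the positive tangent cone.
  have hmin : IsLocalMinOn (EuclideanSpace.proj (𝕜 := ℝ) (0 : Fin 2) ∘ transition c c')
      (range (𝓡∂ 2)) u := by
    refine Eventually.of_forall fun w => ?_
    change transition c c' u 0 ≤ transition c c' w 0
    rw [h0]
    exact mem_range_halfPlane.mp (chart_mem_range c _)
  exact hmin.hasFDerivWithinAt_nonneg hd (mem_posTangentConeAt_of_frequently_mem hv)

/-- Invariance of the boundary. If the image were an interior point, every direction there would be
admissible for the inverse transition, in particular the one whose image is `-e₀`, contradicting
`transitionDeriv_nonneg`. -/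
theorem transition_boundary (hu : u ∈ (extChartAt (𝓡∂ 2) c').target)
    (hS : (extChartAt (𝓡∂ 2) c').symm u ∈ (extChartAt (𝓡∂ 2) c).source) (h0 : u 0 = 0) :
    transition c c' u 0 = 0 := by
  by_contra hne
  have hpos : 0 < transition c c' u 0 :=
    lt_of_le_of_ne (mem_range_halfPlane.mp (chart_mem_range c _)) (Ne.symm hne)
  have hS' : (extChartAt (𝓡∂ 2) c).symm (transition c c' u) ∈ (extChartAt (𝓡∂ 2) c').source := by
    rw [symm_transition hS]
    exact (extChartAt (𝓡∂ 2) c').map_target hu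
  have h := transitionDeriv_nonneg (transition_mem hS) hS'
    (by rw [transition_transition hu hS, h0])
    (v := transitionDeriv c c' u (-EuclideanSpace.single 0 1)) (by
      refine Eventually.frequently ?_
      have hc : Continuous fun t : ℝ => (transition c c' u
          + t • transitionDeriv c c' u (-EuclideanSpace.single 0 1) : E2) 0 := by fun_prop
      have : ∀ᶠ t : ℝ in 𝓝 0, 0 < (transition c c' u
          + t • transitionDeriv c c' u (-EuclideanSpace.single 0 1) : E2) 0 :=
        continuous_const.continuousAt.eventually_lt hc.continuousAt (by simpa using hpos)
      filter_upwards [nhdsWithin_le_nhds this] with t ht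
      exact mem_range_halfPlane.mpr ht.le)
  rw [transitionDeriv_comp hu hS] at h
  norm_num at h

/-- Both `e₁` and `-e₁` stay in the half-plane at a boundary point, so the nonnegativity holds with
both signs. -/
theorem transitionDeriv_tangent (hu : u ∈ (extChartAt (𝓡∂ 2) c').target)
    (hS : (extChartAt (𝓡∂ 2) c').symm u ∈ (extChartAt (𝓡∂ 2) c).source) (h0 : u 0 = 0) :
    transitionDeriv c c' u (EuclideanSpace.single 1 1) 0 = 0 := by
  have h : ∀ a : ℝ, 0 ≤ transitionDeriv c c' u (a • EuclideanSpace.single 1 1) 0 := fun a =>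
    transitionDeriv_nonneg hu hS (transition_boundary hu hS h0)
      (Eventually.of_forall fun t => mem_range_halfPlane.mpr (by simp [h0])).frequently
  have h1 := h 1
  have h2 := h (-1)
  rw [map_smul] at h1 h2
  simp only [PiLp.smul_apply, smul_eq_mul] at h1 h2
  linarith

/-- At a boundary point the differential is triangular and invertible, so both diagonal entries are
nonzero; the inward one is also nonnegative. -/
theorem transitionDeriv_inward_pos_and_tangent_ne_zero (hu : u ∈ (extChartAt (𝓡∂ 2) c').target)
    (hS : (extChartAt (𝓡∂ 2) c').symm u ∈ (extChartAt (𝓡∂ 2) c).source) (h0 : u 0 = 0) :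
    0 < transitionDeriv c c' u (EuclideanSpace.single 0 1) 0
      ∧ transitionDeriv c c' u (EuclideanSpace.single 1 1) 1 ≠ 0 := by
  have hinj : Function.Injective (transitionDeriv c c' u) :=
    Function.LeftInverse.injective (transitionDeriv_comp hu hS)
  have hdet : (transitionDeriv c c' u).det ≠ 0 := by
    rw [ContinuousLinearMap.det]
    exact (LinearEquiv.isUnit_det' (LinearEquiv.ofInjectiveEndo _ hinj)).ne_zero
  rw [det_E2, transitionDeriv_tangent hu hS h0, mul_zero, sub_zero] at hdet
  have hnn : 0 ≤ transitionDeriv c c' u (EuclideanSpace.single 0 1) 0 :=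
    transitionDeriv_nonneg hu hS (transition_boundary hu hS h0) (by
      refine (eventually_nhdsWithin_of_forall fun t ht => ?_).frequently
      exact mem_range_halfPlane.mpr (by simpa [h0] using le_of_lt ht))
  exact ⟨lt_of_le_of_ne hnn (left_ne_zero_of_mul hdet).symm, right_ne_zero_of_mul hdet⟩

end Charts

/-! ### Chart independence of the boundary tangent, the area and the arc length. -/

theorem mk_boundary_apply (t : ℝ) : (!₂[0, t] : E2) 0 = 0 ∧ (!₂[0, t] : E2) 1 = t := by simp

theorem mk_boundary_eq {u : E2} (h : u 0 = 0) : (!₂[0, u 1] : E2) = u := by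
  ext i
  fin_cases i <;> simp [h]

theorem continuous_mk_boundary : Continuous fun t : ℝ => (!₂[0, t] : E2) := by
  refine (PiLp.continuous_toLp 2 _).comp (continuous_pi fun i => ?_)
  fin_cases i
  · exact continuous_const
  · exact continuous_id

theorem hasDerivAt_mk_boundary (t : ℝ) :
    HasDerivAt (fun t : ℝ => (!₂[0, t] : E2)) (EuclideanSpace.single 1 1) t := by
  have h : (fun t : ℝ => (!₂[0, t] : E2)) = fun t => t • EuclideanSpace.single 1 1 := by
    funext t
    ext i
    fin_cases i <;> simp
  rw [h]
  simpa using (hasDerivAt_id t).smul_const (EuclideanSpace.single (1 : Fin 2) (1 : ℝ))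

section Charts

variable {M : Type*} [TopologicalSpace M] [ChartedSpace (EuclideanHalfSpace 2) M]

/-- The parameters of the boundary points in the domain of the chart at `c`. -/
def boundaryDomain (c : M) : Set ℝ := {t : ℝ | (!₂[0, t] : E2) ∈ (extChartAt (𝓡∂ 2) c).target}

theorem measurableSet_boundaryDomain (c : M) : MeasurableSet (boundaryDomain c) :=
  (measurableSet_chart_target c).preimage continuous_mk_boundary.measurable

theorem continuousOn_boundary_param (c : M) :
    ContinuousOn (fun t : ℝ => (extChartAt (𝓡∂ 2) c).symm (!₂[0, t] : E2)) (boundaryDomain c) :=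
  (continuousOn_extChartAt_symm c).comp continuous_mk_boundary.continuousOn fun _ ht => ht

theorem partialParam_combination (X : M → E3) (c : M) (u v : E2) :
    paramDeriv X c u v = v 0 • partialParam X c 0 u + v 1 • partialParam X c 1 u := by
  conv_lhs => rw [E2_eq_smul_add_smul v]
  rw [map_add, map_smul, map_smul, partialParam_eq, partialParam_eq]

variable [IsManifold (𝓡∂ 2) ∞ M] {X N P Q : M → E3}

theorem partialParam_transition (hX : ContMDiff (𝓡∂ 2) 𝓘(ℝ, E3) ∞ X) {c c' : M} {u : E2}
    (hu : u ∈ (extChartAt (𝓡∂ 2) c').target)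
    (hS : (extChartAt (𝓡∂ 2) c').symm u ∈ (extChartAt (𝓡∂ 2) c).source) (i : Fin 2) :
    partialParam X c' i u
      = transitionDeriv c c' u (EuclideanSpace.single i 1) 0 • partialParam X c 0 (transition c c' u)
        + transitionDeriv c c' u (EuclideanSpace.single i 1) 1
          • partialParam X c 1 (transition c c' u) := by
  rw [partialParam_eq X c', paramDeriv_transition hX hu hS, ContinuousLinearMap.comp_apply,
    partialParam_combination]

/-- The formula for the oriented unit tangent of the boundary holds in every chart. -/
theorem boundaryTangent_eq (hX : ContMDiff (𝓡∂ 2) 𝓘(ℝ, E3) ∞ X) {c : M} {u : E2}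
    (hu : u ∈ (extChartAt (𝓡∂ 2) c).target) (h0 : u 0 = 0) :
    boundaryTangent X N ((extChartAt (𝓡∂ 2) c).symm u)
      = ((SignType.sign (inner ℝ (N ((extChartAt (𝓡∂ 2) c).symm u))
          (cross (partialParam X c 1 u) (partialParam X c 0 u)) : ℝ) : ℝ)
        * ‖partialParam X c 1 u‖⁻¹) • partialParam X c 1 u := by
  set p := (extChartAt (𝓡∂ 2) c).symm u with hp
  -- `boundaryTangent` is defined by the preferred chart at `p` itself, so the comparison is between
  -- that chart and the one at `c`.
  have hS : (extChartAt (𝓡∂ 2) c).symm u ∈ (extChartAt (𝓡∂ 2) p).source :=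
    mem_extChartAt_source p
  obtain ⟨hb, ha⟩ := transitionDeriv_inward_pos_and_tangent_ne_zero hu hS h0
  rw [partialParam_transition hX hu hS 0, partialParam_transition hX hu hS 1,
    transitionDeriv_tangent hu hS h0, zero_smul, zero_add, oriented_tangent_eq ha hb]
  rfl

theorem norm_cross_transition (hX : ContMDiff (𝓡∂ 2) 𝓘(ℝ, E3) ∞ X) {c c' : M} {u : E2}
    (hu : u ∈ (extChartAt (𝓡∂ 2) c').target)
    (hS : (extChartAt (𝓡∂ 2) c').symm u ∈ (extChartAt (𝓡∂ 2) c).source) :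
    ‖cross (partialParam X c' 0 u) (partialParam X c' 1 u)‖
      = |(transitionDeriv c c' u).det|
        * ‖cross (partialParam X c 0 (transition c c' u))
            (partialParam X c 1 (transition c c' u))‖ := by
  rw [partialParam_transition hX hu hS 0, partialParam_transition hX hu hS 1, cross_combination,
    norm_smul, Real.norm_eq_abs, det_E2]

variable [MeasurableSpace M] [BorelSpace M]

omit [IsManifold (𝓡∂ 2) ∞ M] in
theorem measurableSet_chart_source (c : M) : MeasurableSet (extChartAt (𝓡∂ 2) c).source :=
  (isOpen_chart_source c).measurableSet

/-- The area density scales by the Jacobian determinant of the transition, so on the domain of one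
chart no other chart contributes more area, and the supremum is attained there. -/
theorem restrict_areaMeasure (hX : ContMDiff (𝓡∂ 2) 𝓘(ℝ, E3) ∞ X) (c : M) :
    (areaMeasure X).restrict (extChartAt (𝓡∂ 2) c).source
      = (chartArea X c).restrict (extChartAt (𝓡∂ 2) c).source := by
  refine restrict_iSup_eq_of_restrict_le (measurableSet_chart_source c) c fun c' => ?_
  exact restrict_map_withDensity_le (measurableSet_chart_target c) (measurableSet_chart_target c')
    (continuousOn_extChartAt_symm c) (continuousOn_extChartAt_symm c')
    (extChartAt (𝓡∂ 2) c').symm.injOn (measurableSet_chart_source c)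
    (ψ := transition c c') (ψ' := transitionDeriv c c')
    (fun u _ hS => transition_mem hS) (fun u _ hS => symm_transition hS)
    (fun u hu hS => (hasFDerivWithinAt_transition hu hS).mono (chart_target_subset c'))
    (fun u hu hS => norm_cross_transition hX hu hS)

theorem restrict_boundaryMeasure (hX : ContMDiff (𝓡∂ 2) 𝓘(ℝ, E3) ∞ X) (c : M) :
    (boundaryMeasure X).restrict (extChartAt (𝓡∂ 2) c).source
      = (chartLength X c).restrict (extChartAt (𝓡∂ 2) c).source := by
  refine restrict_iSup_eq_of_restrict_le (measurableSet_chart_source c) c fun c' => ?_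
  -- Transitions preserve the boundary line, so the induced change of the parameter `t` is their
  -- second coordinate.
  have htr : ∀ t ∈ boundaryDomain c',
      (extChartAt (𝓡∂ 2) c').symm (!₂[0, t] : E2) ∈ (extChartAt (𝓡∂ 2) c).source →
      (!₂[0, transition c c' !₂[0, t] 1] : E2) = transition c c' !₂[0, t] := fun t ht hS =>
    mk_boundary_eq (transition_boundary ht hS (mk_boundary_apply t).1)
  refine restrict_map_withDensity_le (measurableSet_boundaryDomain c)
    (measurableSet_boundaryDomain c') (continuousOn_boundary_param c)
    (continuousOn_boundary_param c') (fun t ht t' ht' h => ?_) (measurableSet_chart_source c)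
    (ψ := fun t => transition c c' !₂[0, t] 1)
    (ψ' := fun t => ContinuousLinearMap.toSpanSingleton ℝ
      (transitionDeriv c c' !₂[0, t] (EuclideanSpace.single 1 1) 1))
    (fun t ht hS => ?_) (fun t ht hS => ?_) (fun t ht hS => ?_) (fun t ht hS => ?_)
  · have := congrArg (fun u : E2 => u 1) ((extChartAt (𝓡∂ 2) c').symm.injOn ht ht' h)
    simpa using this
  · change (!₂[0, transition c c' !₂[0, t] 1] : E2) ∈ (extChartAt (𝓡∂ 2) c).target
    rw [htr t ht hS]
    exact transition_mem hS
  · change (extChartAt (𝓡∂ 2) c).symm (!₂[0, transition c c' !₂[0, t] 1] : E2) = _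
    rw [htr t ht hS]
    exact symm_transition hS
  · have h1 := (hasFDerivWithinAt_transition ht hS).comp_hasDerivWithinAt t
      (hasDerivAt_mk_boundary t).hasDerivWithinAt
      (fun t' ht' => chart_target_subset c' ht' : MapsTo _ (boundaryDomain c') _)
    exact ((EuclideanSpace.proj (𝕜 := ℝ) (1 : Fin 2)).hasFDerivAt.comp_hasDerivWithinAt t
      h1).hasFDerivWithinAt
  · simp only
    rw [partialParam_transition hX ht hS 1, transitionDeriv_tangent ht hS (mk_boundary_apply t).1,
      zero_smul, zero_add, norm_smul, Real.norm_eq_abs, htr t ht hS,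
      ContinuousLinearMap.det_toSpanSingleton]

end Charts

/-! ### Pulling functions back to the half-plane, with the orientation sign. -/

section Pullback

variable {M : Type*} [TopologicalSpace M] [ChartedSpace (EuclideanHalfSpace 2) M]

/-- The function `f` read in the chart at `c`, multiplied by `σ` and extended by zero. -/
noncomputable def chartPullback (X : M → E3) (c : M) (σ : E2 → ℝ) (f : E3 → ℝ) : E2 → ℝ :=
  (extChartAt (𝓡∂ 2) c).target.indicator fun u => σ u * f (localParam X c u)

/-- The image in the chart at `c` of the part of the surface lying in the support of `f`. -/
def chartSupport (X : M → E3) (c : M) (f : E3 → ℝ) : Set E2 :=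
  extChartAt (𝓡∂ 2) c '' (X ⁻¹' tsupport f)

variable {X N P Q : M → E3} {c : M} {f g : E3 → ℝ} {σ : E2 → ℝ}

theorem isCompact_chartSupport [CompactSpace M] (hX : Continuous X)
    (hf : X ⁻¹' tsupport f ⊆ (extChartAt (𝓡∂ 2) c).source) : IsCompact (chartSupport X c f) :=
  (((isClosed_tsupport f).preimage hX).isCompact).image_of_continuousOn
    ((continuousOn_extChartAt c).mono hf)

theorem chartSupport_subset (hf : X ⁻¹' tsupport f ⊆ (extChartAt (𝓡∂ 2) c).source) :
    chartSupport X c f ⊆ (extChartAt (𝓡∂ 2) c).target := by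
  rintro _ ⟨p, hp, rfl⟩
  exact (extChartAt (𝓡∂ 2) c).map_source (hf hp)

theorem chartPullback_eq_zero {u : E2} (hu : u ∉ chartSupport X c f) :
    chartPullback X c σ f u = 0 := by
  by_cases hT : u ∈ (extChartAt (𝓡∂ 2) c).target
  · rw [chartPullback, indicator_of_mem hT]
    have : f (localParam X c u) = 0 := by
      by_contra hne
      exact hu ⟨(extChartAt (𝓡∂ 2) c).symm u, subset_tsupport f hne,
        (extChartAt (𝓡∂ 2) c).right_inv hT⟩
    rw [this, mul_zero]
  · exact indicator_of_notMem hT _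

theorem chartPullback_eventuallyEq {u : E2} (hu : u ∈ (extChartAt (𝓡∂ 2) c).target)
    (hσ : ∀ᶠ v in 𝓝[range (𝓡∂ 2)] u, σ v = σ u) :
    chartPullback X c σ f =ᶠ[𝓝[range (𝓡∂ 2)] u] fun v => σ u * f (localParam X c v) := by
  filter_upwards [hσ, extChartAt_target_mem_nhdsWithin_of_mem hu] with v hv hvT
  rw [chartPullback, indicator_of_mem hvT, hv]

variable [IsManifold (𝓡∂ 2) ∞ M]

theorem fderivWithin_chartPullback (hX : ContMDiff (𝓡∂ 2) 𝓘(ℝ, E3) ∞ X) (hf : ContDiff ℝ 1 f)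
    {u : E2} (hu : u ∈ (extChartAt (𝓡∂ 2) c).target)
    (hσ : ∀ᶠ v in 𝓝[range (𝓡∂ 2)] u, σ v = σ u) (i : Fin 2) :
    fderivWithin ℝ (chartPullback X c σ f) (range (𝓡∂ 2)) u (EuclideanSpace.single i 1)
      = σ u * fderiv ℝ f (localParam X c u) (partialParam X c i u) := by
  have h := (((hf.differentiable one_ne_zero) (localParam X c u)).hasFDerivAt.comp_hasFDerivWithinAt
    u (hasFDerivWithinAt_localParam hX hu)).const_mul (σ u)
  have hev := chartPullback_eventuallyEq (X := X) (f := f) hu hσ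
  have h' := h.congr_of_eventuallyEq hev (hev.self_of_nhdsWithin (chart_target_subset c hu))
  rw [h'.fderivWithin ((𝓡∂ 2).uniqueDiffOn u (chart_target_subset c hu))]
  rfl

/-- The image of the support in the chart is compact, hence closed in the whole plane, so the
extension by zero vanishes near every point outside the target. The factor `σ` is harmless, being
locally constant. -/
theorem contDiffOn_chartPullback [CompactSpace M] (hX : ContMDiff (𝓡∂ 2) 𝓘(ℝ, E3) ∞ X)
    (hf : ContDiff ℝ 1 f) (hfS : X ⁻¹' tsupport f ⊆ (extChartAt (𝓡∂ 2) c).source)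
    (hσ : ∀ u ∈ (extChartAt (𝓡∂ 2) c).target, ∀ᶠ v in 𝓝[range (𝓡∂ 2)] u, σ v = σ u) :
    ContDiffOn ℝ 1 (chartPullback X c σ f) (range (𝓡∂ 2)) := by
  intro u hu
  by_cases hT : u ∈ (extChartAt (𝓡∂ 2) c).target
  · have h1 : ContDiffWithinAt ℝ 1 (localParam X c) (range (𝓡∂ 2)) u :=
      ((contDiffOn_localParam hX c u hT).of_le (by simp)).mono_of_mem_nhdsWithin
        (extChartAt_target_mem_nhdsWithin_of_mem hT)
    have h2 := contDiffWithinAt_const (c := σ u) |>.mul (hf.contDiffAt.comp_contDiffWithinAt u h1)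
    have hev := chartPullback_eventuallyEq (X := X) (f := f) hT (hσ u hT)
    exact h2.congr_of_eventuallyEq hev (hev.self_of_nhdsWithin hu)
  · have hK := isCompact_chartSupport hX.continuous hfS
    have huK : u ∉ chartSupport X c f := fun h => hT (chartSupport_subset hfS h)
    have hev : chartPullback X c σ f =ᶠ[𝓝[range (𝓡∂ 2)] u] fun _ => 0 := by
      filter_upwards [mem_nhdsWithin_of_mem_nhds (hK.isClosed.isOpen_compl.mem_nhds huK)] with v hv
        using chartPullback_eq_zero hv
    exact contDiffWithinAt_const.congr_of_eventuallyEq hev (hev.self_of_nhdsWithin hu)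

/-- The component along `N` of the vector `∂φ/∂u₀ × ∂φ/∂u₁`. -/
noncomputable def orientedDensity (X N : M → E3) (c : M) (u : E2) : ℝ :=
  inner ℝ (N ((extChartAt (𝓡∂ 2) c).symm u))
    (cross (partialParam X c 0 u) (partialParam X c 1 u))

/-- The sign of the chart at `c` with respect to the orientation given by `N`. -/
noncomputable def chartSign (X N : M → E3) (c : M) (u : E2) : ℝ :=
  (SignType.sign (orientedDensity X N c u) : ℝ)

theorem cross_partialParam_ne_zero (hX : IsImmersion (𝓡∂ 2) 𝓘(ℝ, E3) ∞ X) {u : E2}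
    (hu : u ∈ (extChartAt (𝓡∂ 2) c).target) :
    cross (partialParam X c 0 u) (partialParam X c 1 u) ≠ 0 := by
  refine cross_ne_zero fun a b hab => ?_
  have h : paramDeriv X c u (!₂[a, b] : E2) = paramDeriv X c u 0 := by
    rw [partialParam_combination, map_zero, ← hab]
    rfl
  have h' := paramDeriv_injective hX hu h
  exact ⟨congrArg (fun v : E2 => v 0) h', congrArg (fun v : E2 => v 1) h'⟩

theorem partialParam_one_ne_zero (hX : IsImmersion (𝓡∂ 2) 𝓘(ℝ, E3) ∞ X) {u : E2}
    (hu : u ∈ (extChartAt (𝓡∂ 2) c).target) : partialParam X c 1 u ≠ 0 := by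
  intro h
  have h' := paramDeriv_injective hX hu
    ((partialParam_eq X c 1 u).symm.trans (h.trans (map_zero (paramDeriv X c u)).symm))
  exact one_ne_zero (α := ℝ) (by simpa using congrArg (fun v : E2 => v 1) h')

theorem continuousOn_cross_partialParam (hX : ContMDiff (𝓡∂ 2) 𝓘(ℝ, E3) ∞ X) (c : M) :
    ContinuousOn (fun u => cross (partialParam X c 0 u) (partialParam X c 1 u))
      (extChartAt (𝓡∂ 2) c).target :=
  continuous_cross.comp_continuousOn
    ((continuousOn_partialParam hX c 0).prodMk (continuousOn_partialParam hX c 1))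

theorem continuousOn_orientedDensity (hX : ContMDiff (𝓡∂ 2) 𝓘(ℝ, E3) ∞ X) (hN : Continuous N)
    (c : M) : ContinuousOn (orientedDensity X N c) (extChartAt (𝓡∂ 2) c).target :=
  (hN.comp_continuousOn (continuousOn_extChartAt_symm c)).inner (𝕜 := ℝ)
    (continuousOn_cross_partialParam hX c)

theorem abs_orientedDensity (hX : ContMDiff (𝓡∂ 2) 𝓘(ℝ, E3) ∞ X) (hN : IsUnitNormal X N)
    (hPQ : IsOrientedFrame N P Q) {u : E2} (hu : u ∈ (extChartAt (𝓡∂ 2) c).target) :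
    |orientedDensity X N c u| = ‖cross (partialParam X c 0 u) (partialParam X c 1 u)‖ :=
  abs_inner_normal_cross (hPQ.norm_left _) (hPQ.norm_right _) (hPQ.inner_eq_zero _)
    (hPQ.cross_eq _) (inner_normal_paramDeriv hX hN hu _) (inner_normal_paramDeriv hX hN hu _)

/-- The oriented density is continuous, and nonzero because `X` is an immersion. Charts are not
assumed oriented or connected, so the sign may vary within one chart. -/
theorem chartSign_eventuallyEq (hX : IsImmersion (𝓡∂ 2) 𝓘(ℝ, E3) ∞ X) (hN : IsUnitNormal X N)
    (hPQ : IsOrientedFrame N P Q) {u : E2} (hu : u ∈ (extChartAt (𝓡∂ 2) c).target) :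
    ∀ᶠ v in 𝓝[range (𝓡∂ 2)] u, chartSign X N c v = chartSign X N c u := by
  have hne : orientedDensity X N c u ≠ 0 := by
    rw [← abs_pos, abs_orientedDensity hX.contMDiff hN hPQ hu, norm_pos_iff]
    exact cross_partialParam_ne_zero hX hu
  have hc := continuousOn_orientedDensity hX.contMDiff hN.continuous c u hu
  rw [ContinuousWithinAt, nhdsWithin_chart_target hu] at hc
  rcases lt_or_gt_of_ne hne with h | h
  · filter_upwards [hc.eventually_lt_const h] with v hv
    rw [chartSign, chartSign, sign_neg hv, sign_neg h]
  · filter_upwards [hc.eventually_const_lt h] with v hv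
    rw [chartSign, chartSign, sign_pos hv, sign_pos h]

end Pullback

/-! ### Stokes' theorem for functions supported in one chart. -/

section LocalStokes

variable {M : Type*} [TopologicalSpace M] [ChartedSpace (EuclideanHalfSpace 2) M]

/-- The integrand of `∫ f dg` over the boundary. -/
noncomputable def boundaryIntegrand (X N : M → E3) (f g : E3 → ℝ) (p : M) : ℝ :=
  f (X p) * fderiv ℝ g (X p) (boundaryTangent X N p)

/-- The value of `df ∧ dg` on the frame `(P, Q)`. -/
noncomputable def wedgeIntegrand (X P Q : M → E3) (f g : E3 → ℝ) (p : M) : ℝ :=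
  fderiv ℝ f (X p) (P p) * fderiv ℝ g (X p) (Q p) - fderiv ℝ f (X p) (Q p) * fderiv ℝ g (X p) (P p)

/-- The conclusion of Stokes' theorem for the form `f dg`. -/
def StokesHolds [MeasurableSpace M] (X N P Q : M → E3) (f g : E3 → ℝ) : Prop :=
  Integrable (boundaryIntegrand X N f g) (boundaryMeasure X) ∧
  Integrable (wedgeIntegrand X P Q f g) (areaMeasure X) ∧
  ∫ p, boundaryIntegrand X N f g p ∂(boundaryMeasure X)
    = ∫ p, wedgeIntegrand X P Q f g p ∂(areaMeasure X)

variable {X N P Q : M → E3} {c : M} {f g : E3 → ℝ}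

theorem boundaryIntegrand_eq_zero {p : M} (hp : X p ∉ tsupport f) :
    boundaryIntegrand X N f g p = 0 := by
  rw [boundaryIntegrand, image_eq_zero_of_notMem_tsupport hp, zero_mul]

omit [TopologicalSpace M] [ChartedSpace (EuclideanHalfSpace 2) M] in
theorem wedgeIntegrand_eq_zero {p : M} (hp : X p ∉ tsupport f) :
    wedgeIntegrand X P Q f g p = 0 := by
  simp [wedgeIntegrand, fderiv_of_notMem_tsupport ℝ hp]

variable [IsManifold (𝓡∂ 2) ∞ M]

theorem norm_cross_mul_wedgeIntegrand (hX : IsImmersion (𝓡∂ 2) 𝓘(ℝ, E3) ∞ X)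
    (hN : IsUnitNormal X N) (hPQ : IsOrientedFrame N P Q) (hf : ContDiff ℝ 1 f)
    (hg : ContDiff ℝ 1 g) {u : E2} (hu : u ∈ (extChartAt (𝓡∂ 2) c).target) :
    ‖cross (partialParam X c 0 u) (partialParam X c 1 u)‖
        * wedgeIntegrand X P Q f g ((extChartAt (𝓡∂ 2) c).symm u)
      = fderivWithin ℝ (chartPullback X c (chartSign X N c) f) (range (𝓡∂ 2)) u
            (EuclideanSpace.single 0 1)
          * fderivWithin ℝ (chartPullback X c 1 g) (range (𝓡∂ 2)) u (EuclideanSpace.single 1 1)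
        - fderivWithin ℝ (chartPullback X c (chartSign X N c) f) (range (𝓡∂ 2)) u
            (EuclideanSpace.single 1 1)
          * fderivWithin ℝ (chartPullback X c 1 g) (range (𝓡∂ 2)) u
            (EuclideanSpace.single 0 1) := by
  have hσ := chartSign_eventuallyEq (c := c) hX hN hPQ hu
  have h1 : ∀ᶠ v in 𝓝[range (𝓡∂ 2)] u, (1 : E2 → ℝ) v = (1 : E2 → ℝ) u :=
    Eventually.of_forall fun _ => rfl
  rw [fderivWithin_chartPullback hX.contMDiff hf hu hσ,
    fderivWithin_chartPullback hX.contMDiff hf hu hσ,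
    fderivWithin_chartPullback hX.contMDiff hg hu h1,
    fderivWithin_chartPullback hX.contMDiff hg hu h1]
  have key := norm_cross_mul_wedge (hPQ.norm_left ((extChartAt (𝓡∂ 2) c).symm u))
    (hPQ.norm_right _) (hPQ.inner_eq_zero _) (hPQ.cross_eq _)
    (inner_normal_paramDeriv hX.contMDiff hN hu (EuclideanSpace.single 0 1))
    (inner_normal_paramDeriv hX.contMDiff hN hu (EuclideanSpace.single 1 1))
    (fderiv ℝ f (localParam X c u)) (fderiv ℝ g (localParam X c u))
  refine Eq.trans key ?_
  rw [← partialParam_eq, ← partialParam_eq]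
  simp only [chartSign, orientedDensity, Pi.one_apply]
  ring

/-- The minus sign comes from `τ × d` being `∂φ/∂u₁ × ∂φ/∂u₀`, the reverse of the order that defines
`chartSign`. It matches the minus sign in `green_halfPlane`. -/
theorem norm_mul_boundaryIntegrand (hX : IsImmersion (𝓡∂ 2) 𝓘(ℝ, E3) ∞ X)
    (hg : ContDiff ℝ 1 g) {u : E2} (hu : u ∈ (extChartAt (𝓡∂ 2) c).target) (h0 : u 0 = 0) :
    ‖partialParam X c 1 u‖ * boundaryIntegrand X N f g ((extChartAt (𝓡∂ 2) c).symm u)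
      = -(chartPullback X c (chartSign X N c) f u
        * fderivWithin ℝ (chartPullback X c 1 g) (range (𝓡∂ 2)) u
          (EuclideanSpace.single 1 1)) := by
  have h1 : ∀ᶠ v in 𝓝[range (𝓡∂ 2)] u, (1 : E2 → ℝ) v = (1 : E2 → ℝ) u :=
    Eventually.of_forall fun _ => rfl
  have hne : ‖partialParam X c 1 u‖ ≠ 0 := norm_ne_zero_iff.mpr (partialParam_one_ne_zero hX hu)
  have hc : cross (partialParam X c 1 u) (partialParam X c 0 u)
      = (-1 : ℝ) • cross (partialParam X c 0 u) (partialParam X c 1 u) := by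
    simpa using cross_combination (partialParam X c 0 u) (partialParam X c 1 u) 0 1 1 0
  rw [fderivWithin_chartPullback hX.contMDiff hg hu h1, chartPullback, indicator_of_mem hu,
    boundaryIntegrand, boundaryTangent_eq hX.contMDiff hu h0, hc, inner_smul_right, map_smul,
    smul_eq_mul, neg_one_mul, Left.sign_neg, SignType.coe_neg, chartSign, orientedDensity]
  simp only [localParam, Pi.one_apply]
  field_simp

variable [CompactSpace M] [MeasurableSpace M] [BorelSpace M]

theorem stokesHolds_of_tsupport_subset_chart (hX : IsImmersion (𝓡∂ 2) 𝓘(ℝ, E3) ∞ X)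
    (hN : IsUnitNormal X N) (hPQ : IsOrientedFrame N P Q) (hf : ContDiff ℝ 1 f)
    (hg : ContDiff ℝ 1 g) (hfS : X ⁻¹' tsupport f ⊆ (extChartAt (𝓡∂ 2) c).source)
    (hgS : X ⁻¹' tsupport g ⊆ (extChartAt (𝓡∂ 2) c).source) : StokesHolds X N P Q f g := by
  have hXs := hX.contMDiff
  -- The orientation sign is attached to `f` only, so that it enters each product exactly once.
  set F := chartPullback X c (chartSign X N c) f
  set G := chartPullback X c 1 g
  set T := (extChartAt (𝓡∂ 2) c).target
  have hud : UniqueDiffOn ℝ (range (𝓡∂ 2)) := (𝓡∂ 2).uniqueDiffOn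
  have hK := isCompact_chartSupport hXs.continuous hfS
  have hL := isCompact_chartSupport hXs.continuous hgS
  have hF : ContDiffOn ℝ 1 F (range (𝓡∂ 2)) :=
    contDiffOn_chartPullback hXs hf hfS fun u hu => chartSign_eventuallyEq hX hN hPQ hu
  have hG : ContDiffOn ℝ 1 G (range (𝓡∂ 2)) :=
    contDiffOn_chartPullback hXs hg hgS fun u _ => Eventually.of_forall fun _ => rfl
  have sF : ∀ u ∈ range (𝓡∂ 2), u ∉ chartSupport X c f → F u = 0 :=
    fun u _ hu => chartPullback_eq_zero hu
  have sG : ∀ u ∈ range (𝓡∂ 2), u ∉ chartSupport X c g → G u = 0 :=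
    fun u _ hu => chartPullback_eq_zero hu
  have sF' := fderivWithin_eq_zero_of_notMem hK sF
  have cd : ∀ h : E2 → ℝ, ContDiffOn ℝ 1 h (range (𝓡∂ 2)) → ∀ v : E2,
      ContinuousOn (fun u => fderivWithin ℝ h (range (𝓡∂ 2)) u v) (range (𝓡∂ 2)) :=
    fun h hh v => (hh.continuousOn_fderivWithin hud le_rfl).clm_apply continuousOn_const
  set η : E2 → ℝ := fun u =>
    fderivWithin ℝ F (range (𝓡∂ 2)) u (EuclideanSpace.single 0 1)
        * fderivWithin ℝ G (range (𝓡∂ 2)) u (EuclideanSpace.single 1 1)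
      - fderivWithin ℝ F (range (𝓡∂ 2)) u (EuclideanSpace.single 1 1)
        * fderivWithin ℝ G (range (𝓡∂ 2)) u (EuclideanSpace.single 0 1) with hη
  have cη : ContinuousOn η (range (𝓡∂ 2)) :=
    ((cd F hF _).mul (cd G hG _)).sub ((cd F hF _).mul (cd G hG _))
  have sη : ∀ u ∈ range (𝓡∂ 2), u ∉ chartSupport X c f → η u = 0 := by
    intro u hu huK
    simp only [hη, sF' _ u hu huK, zero_mul, sub_zero]
  have hKT := chartSupport_subset hfS
  have iη : IntegrableOn η T :=
    ((cη.mono (hKT.trans (chart_target_subset c))).integrableOn_compact hK).of_forall_sdiff_eq_zero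
      (measurableSet_chart_target c) fun u hu => sη u (chart_target_subset c hu.1) hu.2
  set β : ℝ → ℝ := fun t =>
    F !₂[0, t] * fderivWithin ℝ G (range (𝓡∂ 2)) !₂[0, t] (EuclideanSpace.single 1 1) with hβ
  have hmem : ∀ t : ℝ, (!₂[0, t] : E2) ∈ range (𝓡∂ 2) := fun t =>
    mem_range_halfPlane.mpr (mk_boundary_apply t).1.ge
  have cβ : Continuous β :=
    (hF.continuousOn.comp_continuous continuous_mk_boundary hmem).mul
      ((cd G hG _).comp_continuous continuous_mk_boundary hmem)
  have iβ : Integrable β := by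
    refine cβ.integrable_of_hasCompactSupport (HasCompactSupport.of_support_subset_isCompact
      (hK.image (by fun_prop : Continuous fun u : E2 => u 1)) fun t ht => ⟨!₂[0, t], ?_, by simp⟩)
    by_contra hn
    exact ht (by simp only [hβ, sF _ (hmem t) hn, zero_mul])
  have hw := (continuousOn_cross_partialParam hXs c).norm
  have hwne : ∀ u ∈ T, ‖cross (partialParam X c 0 u) (partialParam X c 1 u)‖ ≠ 0 :=
    fun u hu => norm_ne_zero_iff.mpr (cross_partialParam_ne_zero hX hu)
  have hηeq : ∀ u ∈ T, ‖cross (partialParam X c 0 u) (partialParam X c 1 u)‖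
      * wedgeIntegrand X P Q f g ((extChartAt (𝓡∂ 2) c).symm u) = η u :=
    fun u hu => norm_cross_mul_wedgeIntegrand hX hN hPQ hf hg hu
  -- The frame may be non-measurable; the integrand is nevertheless continuous in the chart, being
  -- `η` divided by the nonvanishing area density.
  have harea := integral_map_withDensity (μ := volume) (measurableSet_chart_target c)
    (measurableSet_chart_source c) (continuousOn_extChartAt_symm c) (continuousOn_extChartAt c)
    (extChartAt (𝓡∂ 2) c).mapsTo_symm (extChartAt (𝓡∂ 2) c).mapsTo
    (fun p hp => (extChartAt (𝓡∂ 2) c).left_inv hp) hw (fun u => norm_nonneg _)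
    (Ψ := wedgeIntegrand X P Q f g)
    (((cη.mono (chart_target_subset c)).div hw hwne).congr fun u hu =>
      eq_div_of_mul_eq (hwne u hu) ((mul_comm _ _).trans (hηeq u hu)))
  rw [integrableOn_congr_fun hηeq (measurableSet_chart_target c),
    setIntegral_congr_fun (measurableSet_chart_target c) hηeq] at harea
  have hv : ContinuousOn (fun t : ℝ => ‖partialParam X c 1 (!₂[0, t] : E2)‖) (boundaryDomain c) :=
    ((continuousOn_partialParam hXs c 1).comp continuous_mk_boundary.continuousOn
      fun _ ht => ht).norm
  have hvne : ∀ t ∈ boundaryDomain c, ‖partialParam X c 1 (!₂[0, t] : E2)‖ ≠ 0 :=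
    fun t ht => norm_ne_zero_iff.mpr (partialParam_one_ne_zero hX ht)
  have hβeq : ∀ t ∈ boundaryDomain c, ‖partialParam X c 1 (!₂[0, t] : E2)‖
      * boundaryIntegrand X N f g ((extChartAt (𝓡∂ 2) c).symm (!₂[0, t] : E2)) = -β t :=
    fun t ht => norm_mul_boundaryIntegrand hX hg ht (mk_boundary_apply t).1
  have hc1 : ContinuousOn (fun p => extChartAt (𝓡∂ 2) c p 1) (extChartAt (𝓡∂ 2) c).source :=
    (by fun_prop : Continuous fun u : E2 => u 1).comp_continuousOn (continuousOn_extChartAt c)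
  have hc0 : ContinuousOn (fun p => extChartAt (𝓡∂ 2) c p 0) (extChartAt (𝓡∂ 2) c).source :=
    (by fun_prop : Continuous fun u : E2 => u 0).comp_continuousOn (continuousOn_extChartAt c)
  -- Here `R` is the set of boundary points in the chart domain, and the inverse of the
  -- parametrization is the coordinate `u 1`.
  have hedge := integral_map_withDensity (μ := volume) (measurableSet_boundaryDomain c)
    (measurableSet_inter_preimage_of_continuousOn (measurableSet_chart_source c) hc0
      (measurableSet_singleton (0 : ℝ)))
    (continuousOn_boundary_param c) (hc1.mono inter_subset_left)
    (fun t ht => ⟨(extChartAt (𝓡∂ 2) c).map_target ht, by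
      rw [mem_preimage, (extChartAt (𝓡∂ 2) c).right_inv ht]
      exact (mk_boundary_apply t).1⟩)
    (fun p hp => by
      change (!₂[0, extChartAt (𝓡∂ 2) c p 1] : E2) ∈ (extChartAt (𝓡∂ 2) c).target
      rw [mk_boundary_eq hp.2]
      exact (extChartAt (𝓡∂ 2) c).map_source hp.1)
    (fun p hp => by
      simp only
      rw [mk_boundary_eq hp.2]
      exact (extChartAt (𝓡∂ 2) c).left_inv hp.1)
    hv (fun t => norm_nonneg _) (Ψ := boundaryIntegrand X N f g)
    ((cβ.neg.continuousOn.div hv hvne).congr fun t ht =>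
      eq_div_of_mul_eq (hvne t ht) ((mul_comm _ _).trans (hβeq t ht)))
  rw [integrableOn_congr_fun hβeq (measurableSet_boundaryDomain c),
    setIntegral_congr_fun (measurableSet_boundaryDomain c) hβeq] at hedge
  have zB : ∀ p ∉ (extChartAt (𝓡∂ 2) c).source, boundaryIntegrand X N f g p = 0 :=
    fun p hp => boundaryIntegrand_eq_zero fun h => hp (hfS h)
  have zW : ∀ p ∉ (extChartAt (𝓡∂ 2) c).source, wedgeIntegrand X P Q f g p = 0 :=
    fun p hp => wedgeIntegrand_eq_zero fun h => hp (hfS h)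
  refine ⟨?_, ?_, ?_⟩
  · rw [← integrableOn_iff_integrable_of_support_subset (Function.support_subset_iff'.mpr zB),
      IntegrableOn, restrict_boundaryMeasure hXs]
    exact (hedge.1 iβ.neg.integrableOn).integrableOn
  · rw [← integrableOn_iff_integrable_of_support_subset (Function.support_subset_iff'.mpr zW),
      IntegrableOn, restrict_areaMeasure hXs]
    exact (harea.1 iη).integrableOn
  · rw [← setIntegral_eq_integral_of_forall_compl_eq_zero zB,
      ← setIntegral_eq_integral_of_forall_compl_eq_zero zW, restrict_boundaryMeasure hXs,
      restrict_areaMeasure hXs, setIntegral_eq_integral_of_forall_compl_eq_zero zB,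
      setIntegral_eq_integral_of_forall_compl_eq_zero zW]
    refine hedge.2.trans (Eq.trans ?_ harea.2.symm)
    rw [setIntegral_eq_integral_of_forall_compl_eq_zero, integral_neg, hβ,
      ← green_halfPlane hK hL hF hG sF sG]
    · exact setIntegral_eq_of_subset_of_forall_sdiff_eq_zero measurableSet_range_halfPlane
        (chart_target_subset c) fun u hu => sη u hu.1 fun h => hu.2 (hKT h)
    · intro t ht
      simp only [hβ, sF _ (hmem t) fun h => ht (hKT h), zero_mul, neg_zero]

end LocalStokes

/-! ### Globalization by a partition of unity. -/

theorem contDiff_mul_of_tsupport_subset {ρ f : E3 → ℝ} {U : Set E3} (hU : IsOpen U)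
    (hρ : ContDiff ℝ 1 ρ) (hf : ContDiffOn ℝ 1 f U) (h : tsupport ρ ⊆ U) :
    ContDiff ℝ 1 fun x => ρ x * f x := by
  refine contDiff_iff_contDiffAt.mpr fun x => ?_
  by_cases hx : x ∈ tsupport ρ
  · exact hρ.contDiffAt.mul (hf.contDiffAt (hU.mem_nhds (h hx)))
  · have hev := notMem_tsupport_iff_eventuallyEq.mp hx
    refine (contDiffAt_const (c := (0 : ℝ))).congr_of_eventuallyEq ?_
    filter_upwards [hev] with y hy
    rw [hy, Pi.zero_apply, zero_mul]

/-- A cut-off function that is `1` near a closed set, with support in a given neighbourhood. -/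
theorem exists_cutoff {A V : Set E3} (hA : IsClosed A) (hV : IsOpen V) (h : A ⊆ V) :
    ∃ χ : E3 → ℝ, ContDiff ℝ 1 χ ∧ (∀ x ∈ A, χ =ᶠ[𝓝 x] 1) ∧ tsupport χ ⊆ V := by
  obtain ⟨W, hW, hAW, hWV⟩ := normal_exists_closure_subset hA hV h
  obtain ⟨χ, h1, h0, -⟩ := exists_contMDiffMap_one_nhds_of_subset_interior 𝓘(ℝ, E3) (n := 1) hA
    (hAW.trans (interior_maximal subset_closure hW))
  refine ⟨χ, contMDiff_iff_contDiff.mp χ.contMDiff, fun x hx => ?_, ?_⟩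
  · exact (h1.filter_mono (nhds_le_nhdsSet hx))
  · refine (closure_minimal (fun x hx => ?_) isClosed_closure).trans hWV
    by_contra hn
    exact hx (h0 x hn)

section Global

variable {M : Type*} [TopologicalSpace M] [ChartedSpace (EuclideanHalfSpace 2) M]
  [MeasurableSpace M] {X N P Q : M → E3}

theorem StokesHolds.congr_right {f g g' : E3 → ℝ} (h : StokesHolds X N P Q f g')
    (hg : ∀ x ∈ tsupport f, g =ᶠ[𝓝 x] g') : StokesHolds X N P Q f g := by
  have hB : boundaryIntegrand X N f g = boundaryIntegrand X N f g' := by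
    funext p
    by_cases hp : X p ∈ tsupport f
    · rw [boundaryIntegrand, boundaryIntegrand, (hg _ hp).fderiv_eq]
    · rw [boundaryIntegrand_eq_zero hp, boundaryIntegrand_eq_zero hp]
  have hW : wedgeIntegrand X P Q f g = wedgeIntegrand X P Q f g' := by
    funext p
    by_cases hp : X p ∈ tsupport f
    · rw [wedgeIntegrand, wedgeIntegrand, (hg _ hp).fderiv_eq]
    · rw [wedgeIntegrand_eq_zero hp, wedgeIntegrand_eq_zero hp]
  rwa [StokesHolds, hB, hW]

/-- Both integrands are linear in `f`. The decomposition must hold near the points of the surface,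
since ambient derivatives of `f` occur. -/
theorem stokesHolds_of_sum {ι : Type*} [Fintype ι] {f g : E3 → ℝ} {F : ι → E3 → ℝ}
    (hF : ∀ i, Differentiable ℝ (F i)) (hf : ∀ p, f =ᶠ[𝓝 (X p)] fun x => ∑ i, F i x)
    (h : ∀ i, StokesHolds X N P Q (F i) g) : StokesHolds X N P Q f g := by
  have hB : boundaryIntegrand X N f g = fun p => ∑ i, boundaryIntegrand X N (F i) g p := by
    funext p
    simp only [boundaryIntegrand]
    rw [(hf p).eq_of_nhds, Finset.sum_mul]
  have hW : wedgeIntegrand X P Q f g = fun p => ∑ i, wedgeIntegrand X P Q (F i) g p := by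
    funext p
    simp only [wedgeIntegrand]
    rw [(hf p).fderiv_eq, fderiv_fun_sum fun i _ => hF i (X p), sum_apply,
      sum_apply, Finset.sum_mul, Finset.sum_mul, Finset.sum_sub_distrib]
  rw [StokesHolds, hB, hW]
  refine ⟨integrable_finsetSum _ fun i _ => (h i).1, integrable_finsetSum _ fun i _ => (h i).2.1,
    ?_⟩
  rw [integral_finsetSum _ fun i _ => (h i).1, integral_finsetSum _ fun i _ => (h i).2.1]
  exact Finset.sum_congr rfl fun i _ => (h i).2.2

variable [CompactSpace M] [IsManifold (𝓡∂ 2) ∞ M] [BorelSpace M]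

/-- Stokes' theorem for the form `f dg` on a compact embedded surface, with `f` and `g` of
class `C¹` near the surface. -/
theorem stokesHolds (hX : IsSmoothEmbedding (𝓡∂ 2) 𝓘(ℝ, E3) ∞ X) (hN : IsUnitNormal X N)
    (hPQ : IsOrientedFrame N P Q) {U : Set E3} (hU : IsOpen U) (hXU : range X ⊆ U) {f g : E3 → ℝ}
    (hf : ContDiffOn ℝ 1 f U) (hg : ContDiffOn ℝ 1 g U) : StokesHolds X N P Q f g := by
  have hXc : Continuous X := hX.isEmbedding.continuous
  -- As `X` is an embedding, chart domains are traces of open sets of the ambient space, so the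
  -- cutting off can be done there.
  have hO : ∀ c : M, ∃ O : Set E3, IsOpen O ∧ X ⁻¹' O = (extChartAt (𝓡∂ 2) c).source := fun c =>
    hX.isEmbedding.isInducing.isOpen_iff.mp (isOpen_chart_source c)
  choose O hOo hOS using hO
  have hVo : ∀ c, IsOpen (O c ∩ U) := fun c => (hOo c).inter hU
  have hcover : range X ⊆ ⋃ c, O c ∩ U := by
    rintro _ ⟨p, rfl⟩
    refine mem_iUnion.mpr ⟨p, ?_, hXU (mem_range_self p)⟩
    have : p ∈ X ⁻¹' O p := by
      rw [hOS]
      exact mem_extChartAt_source p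
    exact this
  obtain ⟨s, hs⟩ := (isCompact_range hXc).elim_finite_subcover _ hVo hcover
  have hs' : range X ⊆ ⋃ i : s, O i ∩ U := by
    rwa [iUnion_subtype (fun c => c ∈ s) fun i => O i ∩ U]
  -- The partition should sum to `1` on a neighbourhood of the surface, not merely on it, so that
  -- derivatives of the sum agree with those of `f`.
  obtain ⟨L, hL, hXL, hLV⟩ := exists_compact_between (isCompact_range hXc)
    (isOpen_iUnion fun i : s => hVo i) hs'
  obtain ⟨ρ, hρ⟩ := SmoothPartitionOfUnity.exists_isSubordinate 𝓘(ℝ, E3) hL.isClosed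
    (fun i : s => O i ∩ U) (fun i => hVo i) hLV
  have hρd : ∀ i, ContDiff ℝ 1 (ρ i) := fun i =>
    (contMDiff_iff_contDiff.mp (ρ i).contMDiff).of_le (by simp)
  have hρf : ∀ i, ContDiff ℝ 1 fun x => ρ i x * f x := fun i =>
    contDiff_mul_of_tsupport_subset hU (hρd i) hf ((hρ i).trans inter_subset_right)
  have hsub : ∀ (i : s) (k h : E3 → ℝ), tsupport k ⊆ O i ∩ U →
      X ⁻¹' tsupport (fun x => k x * h x) ⊆ (extChartAt (𝓡∂ 2) (i : M)).source := by
    intro i k h hk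
    rw [← hOS]
    exact preimage_mono (tsupport_mul_subset_left.trans (hk.trans inter_subset_left))
  refine stokesHolds_of_sum (F := fun i x => ρ i x * f x)
    (fun i => (hρf i).differentiable one_ne_zero) (fun p => ?_) fun i => ?_
  · filter_upwards [isOpen_interior.mem_nhds (hXL (mem_range_self p))] with x hx
    rw [← Finset.sum_mul, ← finsum_eq_sum_of_fintype, ρ.sum_eq_one (interior_subset hx), one_mul]
  -- The chart version also requires `g` to be supported in the chart. Replacing `g` by `χ g`
  -- changes nothing where `ρ i * f` or its derivative is nonzero.
  · obtain ⟨χ, hχ, hχ1, hχV⟩ := exists_cutoff (isClosed_tsupport (ρ i)) (hVo i) (hρ i)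
    refine StokesHolds.congr_right (g' := fun x => χ x * g x)
      (stokesHolds_of_tsupport_subset_chart hX.isImmersion hN hPQ (hρf i)
        (contDiff_mul_of_tsupport_subset hU hχ hg (hχV.trans inter_subset_right))
        (hsub i _ _ (hρ i)) (hsub i _ _ hχV)) fun x hx => ?_
    filter_upwards [hχ1 x (tsupport_mul_subset_left hx)] with y hy
    rw [hy, Pi.one_apply, one_mul]

end Global

/-! ### From functions to vector fields. -/

theorem fderiv_coord {V : E3 → E3} {x : E3} (hV : DifferentiableAt ℝ V x) (i : Fin 3) (v : E3) :
    fderiv ℝ (fun y => V y i) x v = fderiv ℝ V x v i := by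
  have h := ((EuclideanSpace.proj (𝕜 := ℝ) i).hasFDerivAt (x := V x)).comp x hV.hasFDerivAt
  have h' : fderiv ℝ (fun y => V y i) x = _ := h.fderiv
  rw [h']
  rfl

end EmbeddedSurface

theorem mainTheorem7
    {M : Type*} [TopologicalSpace M] [CompactSpace M]
    [ChartedSpace (EuclideanHalfSpace 2) M] [IsManifold (𝓡∂ 2) ∞ M]
    [MeasurableSpace M] [BorelSpace M]
    (X : M → EmbeddedSurface.E3)
    (hX : IsSmoothEmbedding (𝓡∂ 2) 𝓘(ℝ, EmbeddedSurface.E3) ∞ X)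
    (N : M → EmbeddedSurface.E3) (hN : EmbeddedSurface.IsUnitNormal X N)
    (P Q : M → EmbeddedSurface.E3) (hPQ : EmbeddedSurface.IsOrientedFrame N P Q)
    (U : Set EmbeddedSurface.E3) (hU : IsOpen U) (hXU : range X ⊆ U) :
    (∀ f g : EmbeddedSurface.E3 → ℝ, ContDiffOn ℝ 1 f U → ContDiffOn ℝ 1 g U →
      Integrable (fun p => f (X p) * fderiv ℝ g (X p) (EmbeddedSurface.boundaryTangent X N p))
        (EmbeddedSurface.boundaryMeasure X) ∧
      Integrable (fun p => fderiv ℝ f (X p) (P p) * fderiv ℝ g (X p) (Q p)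
          - fderiv ℝ f (X p) (Q p) * fderiv ℝ g (X p) (P p))
        (EmbeddedSurface.areaMeasure X) ∧
      ∫ p, f (X p) * fderiv ℝ g (X p) (EmbeddedSurface.boundaryTangent X N p)
          ∂(EmbeddedSurface.boundaryMeasure X)
        = ∫ p, (fderiv ℝ f (X p) (P p) * fderiv ℝ g (X p) (Q p)
            - fderiv ℝ f (X p) (Q p) * fderiv ℝ g (X p) (P p))
          ∂(EmbeddedSurface.areaMeasure X)) ∧
    (∀ V W : EmbeddedSurface.E3 → EmbeddedSurface.E3, ContDiffOn ℝ 1 V U → ContDiffOn ℝ 1 W U →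
      Integrable (fun p =>
          inner ℝ (V (X p)) (fderiv ℝ W (X p) (EmbeddedSurface.boundaryTangent X N p)))
        (EmbeddedSurface.boundaryMeasure X) ∧
      Integrable (fun p => inner ℝ (fderiv ℝ V (X p) (P p)) (fderiv ℝ W (X p) (Q p))
          - inner ℝ (fderiv ℝ V (X p) (Q p)) (fderiv ℝ W (X p) (P p)))
        (EmbeddedSurface.areaMeasure X) ∧
      ∫ p, inner ℝ (V (X p)) (fderiv ℝ W (X p) (EmbeddedSurface.boundaryTangent X N p))
          ∂(EmbeddedSurface.boundaryMeasure X)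
        = ∫ p, (inner ℝ (fderiv ℝ V (X p) (P p)) (fderiv ℝ W (X p) (Q p))
            - inner ℝ (fderiv ℝ V (X p) (Q p)) (fderiv ℝ W (X p) (P p)))
          ∂(EmbeddedSurface.areaMeasure X)) := by
  have key : ∀ f g : EmbeddedSurface.E3 → ℝ, ContDiffOn ℝ 1 f U → ContDiffOn ℝ 1 g U →
      EmbeddedSurface.StokesHolds X N P Q f g := fun f g hf hg =>
    EmbeddedSurface.stokesHolds hX hN hPQ hU hXU hf hg
  refine ⟨key, fun V W hV hW => ?_⟩
  have hcoord : ∀ Z : EmbeddedSurface.E3 → EmbeddedSurface.E3, ContDiffOn ℝ 1 Z U →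
      ∀ i : Fin 3, ContDiffOn ℝ 1 (fun x => Z x i) U := fun Z hZ i =>
    (EuclideanSpace.proj (𝕜 := ℝ) i).contDiff.comp_contDiffOn hZ
  have hd : ∀ Z : EmbeddedSurface.E3 → EmbeddedSurface.E3, ContDiffOn ℝ 1 Z U →
      ∀ p, DifferentiableAt ℝ Z (X p) := fun Z hZ p =>
    (hZ.contDiffAt (hU.mem_nhds (hXU (mem_range_self p)))).differentiableAt one_ne_zero
  -- `V · dW` is the sum of the forms `Vᵢ dWᵢ`, so the scalar identity is applied to each pair of
  -- coordinates.
  have h := fun i : Fin 3 => key _ _ (hcoord V hV i) (hcoord W hW i)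
  have hB : (fun p => (inner ℝ (V (X p))
        (fderiv ℝ W (X p) (EmbeddedSurface.boundaryTangent X N p)) : ℝ))
      = fun p => ∑ i, EmbeddedSurface.boundaryIntegrand X N (fun x => V x i) (fun x => W x i) p := by
    funext p
    simp only [EmbeddedSurface.boundaryIntegrand, EmbeddedSurface.fderiv_coord (hd W hW p),
      EmbeddedSurface.inner_E3, Fin.sum_univ_three]
  have hA : (fun p => (inner ℝ (fderiv ℝ V (X p) (P p)) (fderiv ℝ W (X p) (Q p))
        - inner ℝ (fderiv ℝ V (X p) (Q p)) (fderiv ℝ W (X p) (P p)) : ℝ))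
      = fun p => ∑ i, EmbeddedSurface.wedgeIntegrand X P Q (fun x => V x i) (fun x => W x i) p := by
    funext p
    simp only [EmbeddedSurface.wedgeIntegrand, EmbeddedSurface.fderiv_coord (hd W hW p),
      EmbeddedSurface.fderiv_coord (hd V hV p), EmbeddedSurface.inner_E3, Fin.sum_univ_three]
    ring
  rw [hB, hA]
  refine ⟨integrable_finsetSum _ fun i _ => (h i).1, integrable_finsetSum _ fun i _ => (h i).2.1,
    ?_⟩
  rw [integral_finsetSum _ fun i _ => (h i).1, integral_finsetSum _ fun i _ => (h i).2.1]
  exact Finset.sum_congr rfl fun i _ => (h i).2.2
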